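/- Let an L-function mean an element of the extended Selberg class: a function $L$ given for $\operatorname{Re}s>1$ by a Dirichlet series $L(s)=\sum_{n\ge1}a(n)n^{-s}$ with $a(1)=1$ such that (i) $a(n)\ll n^{\varepsilon}$ for every $\varepsilon>0$; (ii) for some integer $k\ge0$, $(s-1)^kL(s)$ extends to an entire function of finite order; (iii) $L$ satisfies a functional equation $\Lambda_L(s)=\omega\overline{\Lambda_L(1-\bar s)}$, where $\Lambda_L(s)=L(s)Q^s\prod_{j=1}^K\Gamma(\lambda_js+\mu_j)$ with $K\ge0$, $Q>0$, $\lambda_j>0$, $\operatorname{Re}\mu_j\ge0$, $|\omega|=1$. Two L-functions satisfy the same functional equation if (iii) holds for both with the same $Q,\lambda_j,\mu_j,\omega$. For a meromorphic function $f$ on $\mathbb C$ with Nevanlinna characteristic $T(r,f)$ put $\rho(f)=\limsup_{r\to\infty}\log^+T(r,f)/\log r\in[0,\infty]$. Theorem. Let $h$ be a transcendental (that is, non-rational) meromorphic function on $\mathbb C$ with at least one pole, whose order $\rho(h)$ is finite and not a positive integer. If $L_1,L_2$ are L-functions satisfying the same functional equation, and $L_1-h$ and $L_2-h$ have the same zeros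 counting multiplicities, then $L_1\equiv L_2$ (as meromorphic functions). The condition on the order cannot be dropped: there are L-functions $L_1\not\equiv L_2$ satisfying the same functional equation such that for every positive integer $m$ the function $$h_m(s)=\frac{e^{s^m}L_2(s)-L_1(s)}{e^{s^m}-1}$$ is transcendental meromorphic with at least one pole and order $\rho(h_m)=m$, and $L_1-h_m$, $L_2-h_m$ have the same zeros counting multiplicities; and the same holds for $$h_\infty(s)=\frac{\exp(e^s)L_2(s)-L_1(s)}{\exp(e^s)-1},$$ with $\rho(h_\infty)=\infty$. -/

import Mathlib

open Filter Polynomial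
open scoped ComplexConjugate

noncomputable section

namespace MovingTarget

/-- The parameters of a functional equation of Riemann type:
`K`, `Q > 0`, `lam j > 0`, `Re (mu j) ≥ 0` for `j < K`, and `|omega| = 1`
(`K = 0`, i.e. no gamma factor, is allowed). -/
structure FEData where
  K : ℕ
  Q : ℝ
  lam : Fin K → ℝ
  mu : Fin K → ℂ
  omega : ℂ
  Q_pos : 0 < Q
  lam_pos : ∀ j, 0 < lam j
  mu_re_nonneg : ∀ j, 0 ≤ (mu j).re
  norm_omega : ‖omega‖ = 1

/-- The completed function `Λ(s) = L(s) Q^s ∏ⱼ Γ(λⱼ s + μⱼ)`. -/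
def FEData.completed (F : FEData) (L : ℂ → ℂ) (s : ℂ) : ℂ :=
  L s * (F.Q : ℂ) ^ s * ∏ j, Complex.Gamma ((F.lam j : ℂ) * s + F.mu j)

/-- `L` satisfies the functional equation `Λ(s) = ω * conj (Λ (1 - conj s))` with the parameters
`F`. It is an identity of meromorphic functions, so it is required outside a closed discrete set
(the values that Lean assigns at poles are irrelevant). -/
def SatisfiesFE (F : FEData) (L : ℂ → ℂ) : Prop :=
  F.completed L =ᶠ[codiscrete ℂ] fun s => F.omega * conj (F.completed L (1 - conj s))

/-- An entire function of finite order: `|G(s)| = O(exp(|s|^A))` as `|s| → ∞`, for some `A`. -/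
def IsEntireOfFiniteOrder (G : ℂ → ℂ) : Prop :=
  Differentiable ℂ G ∧ ∃ A : ℝ, G =O[Bornology.cobounded ℂ] fun s => Real.exp (‖s‖ ^ A)

/-- `L` is an L-function, i.e. an element of the extended Selberg class: it is the meromorphic
continuation of a Dirichlet series with leading coefficient `1` satisfying the Ramanujan
hypothesis, the analytic continuation axiom, and some functional equation of Riemann type.
The value `L 1` is left free, as `1` may be a pole. -/
structure IsLFunction (L : ℂ → ℂ) : Prop where
  dirichlet_series : ∃ a : ℕ → ℂ, a 1 = 1 ∧
    (∀ ε : ℝ, 0 < ε → a =O[atTop] fun n : ℕ => (n : ℝ) ^ ε) ∧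
    ∀ s : ℂ, 1 < s.re → L s = LSeries a s
  continuation : ∃ (k : ℕ) (G : ℂ → ℂ), IsEntireOfFiniteOrder G ∧
    ∀ s : ℂ, s ≠ 1 → (s - 1) ^ k * L s = G s
  functional_equation : ∃ F : FEData, SatisfiesFE F L

/-- The order `ρ(f) = limsup_{r → ∞} log⁺ T(r, f) / log r ∈ [0, ∞]` of a meromorphic function,
where `T(r, f) = m(r, f) + N(r, f)` is the Nevanlinna characteristic. -/
def growthOrder (f : ℂ → ℂ) : EReal :=
  limsup (fun r : ℝ =>
    ((Real.posLog (ValueDistribution.characteristic f ⊤ r) / Real.log r : ℝ) : EReal)) atTop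

/-- `f` is, as a meromorphic function, a rational function. -/
def IsRational (f : ℂ → ℂ) : Prop :=
  ∃ p q : ℂ[X], q ≠ 0 ∧ f =ᶠ[codiscrete ℂ] fun s => p.eval s / q.eval s

/-- A transcendental meromorphic function on the plane: meromorphic and not rational. -/
def IsTranscendentalMeromorphic (f : ℂ → ℂ) : Prop :=
  Meromorphic f ∧ ¬ IsRational f

/-- `f` has at least one pole in the plane. -/
def HasPole (f : ℂ → ℂ) : Prop :=
  ∃ z : ℂ, meromorphicOrderAt f z < 0

/-- The meromorphic functions `f` and `g` have the same zeros counting multiplicities: at each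
point the multiplicity of the zero, `max (order) 0`, is the same. -/
def SameZeros (f g : ℂ → ℂ) : Prop :=
  ∀ z : ℂ, max (meromorphicOrderAt f z) 0 = max (meromorphicOrderAt g z) 0

/-- The moving target `(e^g L₂ - L₁) / (e^g - 1)`. -/
def target (g L₁ L₂ : ℂ → ℂ) (s : ℂ) : ℂ :=
  (Complex.exp (g s) * L₂ s - L₁ s) / (Complex.exp (g s) - 1)

end MovingTarget

end

/-! # L-functions sharing a moving target

Suppose that `L₁` and `L₂` are distinct, satisfy the same functional equation, and that `L₁ - h` and
`L₂ - h` have the same zeros, where `h` has finite order. Off the point `1` the L-functions are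
analytic, so `L₁ - h` and `L₂ - h` also have the same poles there, and their quotient `Φ` has no
zeros and poles except possibly at `1`. L-functions have order at most one
(`IsLFunction.hasOrderLE`), so `Φ` has finite order and is `(s - 1) ^ n * exp (p s)` with a
polynomial `p` (`exists_multiplier`). Solving for `h` gives `h = (Φ L₂ - L₁) / (Φ - 1)`, and the
point of the proof is that such a function has order `max 1 (deg p)`, a positive integer
(`growthOrder_movingTarget`).

The order is at most `max 1 (deg p)` since L-functions have order at most one. As `Φ` is in turn
`(h - L₁) / (h - L₂)`, the order is at least `deg p` when `deg p ≥ 2`. The remaining case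
`deg p ≤ 1` needs the lower bound `1`, which is where the common functional equation enters. In a
sector of the left half-plane `Φ` tends to `0`, tends to `∞` or is a constant other than `1`
(`exists_sector_norm_sub_one_ge`). The functional equation expresses `Φ L₂ - L₁` there as a factor
that grows exponentially (`FEData.exists_exp_mul_le`) times a combination `Φ l₂ - l₁` of values
`l₁`, `l₂` close to `1`. Therefore `log |h|` is at least `c |s|` in the sector, and the proximity
function of `h` grows at least linearly. The growth fails only if there is no Gamma factor and `Q ≤ 1`, and
then both L-functions are the constant `1` (`IsLFunction.eq_one_of_K_eq_zero`).

Finite order is handled through `HasOrderLE`, a bound on the Nevanlinna characteristic. That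
`exp g` of finite order forces `g` to be a polynomial, and that `exp p` has order `deg p`, follow
from an estimate of the Taylor coefficients of `g` by the characteristic of `exp g`
(`norm_taylorCoeff_mul_pow_le_characteristic`). The order of `L` is at most one by the
Phragmén-Lindelöf principle and crude bounds for the Gamma function in place of Stirling's formula.

For the converse, `1 + 2 · 4^{-s}` and `1 + 2^{-s} + 2 · 4^{-s}` satisfy the same functional
equation, and their difference has no zeros. The order of the target with `Φ = exp (s ^ m)` is a
case of `growthOrder_movingTarget`; the target with `Φ = exp (exp s)` has infinite order because `exp` is
not a polynomial.
-/

/-! ### Meromorphic functions of finite order -/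

namespace MovingTarget

open ValueDistribution Asymptotics Topology

/-- `f` has order at most `ρ`: its Nevanlinna characteristic is `O(r ^ (ρ + ε))` for every
`ε > 0`. Unlike a bound for `growthOrder`, this passes to sums, products and quotients directly. -/
def HasOrderLE (f : ℂ → ℂ) (ρ : ℝ) : Prop :=
  ∀ ε : ℝ, 0 < ε → characteristic f ⊤ =O[atTop] fun r : ℝ => r ^ (ρ + ε)

lemma isBigO_rpow_atTop_of_le {a b : ℝ} (h : a ≤ b) :
    (fun r : ℝ => r ^ a) =O[atTop] fun r : ℝ => r ^ b := by
  refine IsBigO.of_bound 1 ?_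
  filter_upwards [eventually_ge_atTop 1] with r hr
  have : 0 ≤ r := by linarith
  rw [one_mul, Real.norm_of_nonneg (by positivity), Real.norm_of_nonneg (by positivity)]
  exact Real.rpow_le_rpow_of_exponent_le hr h

lemma isBigO_one_rpow_atTop {a : ℝ} (h : 0 ≤ a) :
    (fun _ : ℝ => (1 : ℝ)) =O[atTop] fun r : ℝ => r ^ a := by
  simpa using isBigO_rpow_atTop_of_le h

lemma isBigO_of_eventually_le {f g : ℝ → ℝ} (hf : 0 ≤ᶠ[atTop] f) (h : f ≤ᶠ[atTop] g) :
    f =O[atTop] g := by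
  refine IsBigO.of_bound 1 ?_
  filter_upwards [hf, h] with r h0 h1
  have h0' : 0 ≤ f r := h0
  rw [one_mul, Real.norm_of_nonneg h0', Real.norm_of_nonneg (h0'.trans h1)]
  exact h1

variable {f g : ℂ → ℂ} {ρ σ : ℝ}

lemma HasOrderLE.mono (hf : HasOrderLE f ρ) (h : ρ ≤ σ) : HasOrderLE f σ :=
  fun ε hε => (hf ε hε).trans (isBigO_rpow_atTop_of_le (by linarith))

lemma HasOrderLE.congr (hf : HasOrderLE f ρ) (h : f =ᶠ[codiscrete ℂ] g) : HasOrderLE g ρ := by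
  intro ε hε
  refine (hf ε hε).congr' ?_ EventuallyEq.rfl
  filter_upwards [eventually_ne_atTop 0] with r hr
  exact characteristic_congr_codiscrete h hr

lemma hasOrderLE_of_characteristic_le {F : ℝ → ℝ}
    (h : ∀ᶠ r in atTop, characteristic f ⊤ r ≤ F r)
    (hF : ∀ ε : ℝ, 0 < ε → F =O[atTop] fun r : ℝ => r ^ (ρ + ε)) : HasOrderLE f ρ :=
  fun ε hε => (isBigO_of_eventually_le characteristic_eventually_nonneg h).trans (hF ε hε)

lemma HasOrderLE.add (mf : Meromorphic f) (mg : Meromorphic g) (hρ : 0 ≤ ρ)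
    (hf : HasOrderLE f ρ) (hg : HasOrderLE g ρ) : HasOrderLE (f + g) ρ := by
  refine hasOrderLE_of_characteristic_le (characteristic_add_top_eventuallyLE mf mg) fun ε hε => ?_
  refine ((hf ε hε).add (hg ε hε)).add ?_
  exact (isBigO_const_const (Real.log 2) one_ne_zero _).trans (isBigO_one_rpow_atTop (by linarith))

lemma HasOrderLE.neg (hf : HasOrderLE f ρ) : HasOrderLE (-f) ρ := by
  have : characteristic (-f) ⊤ = characteristic f ⊤ := by
    funext r
    have h : MeromorphicOn.divisor (-f) Set.univ = MeromorphicOn.divisor f Set.univ := by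
      ext z
      simp only [MeromorphicOn.divisor_def, ← meromorphicOrderAt_neg]
      congr 2
      refine propext ⟨fun h => ?_, fun h => h.neg⟩
      simpa using h.neg
    simp [characteristic, proximity_top, logCounting_top, h]
  intro ε hε
  rw [this]
  exact hf ε hε

lemma HasOrderLE.sub (mf : Meromorphic f) (mg : Meromorphic g) (hρ : 0 ≤ ρ)
    (hf : HasOrderLE f ρ) (hg : HasOrderLE g ρ) : HasOrderLE (f - g) ρ := by
  rw [sub_eq_add_neg]
  exact HasOrderLE.add mf mg.neg hρ hf hg.neg

lemma HasOrderLE.inv (mf : Meromorphic f) (hρ : 0 ≤ ρ) (hf : HasOrderLE f ρ) :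
    HasOrderLE f⁻¹ ρ := by
  intro ε hε
  have h := (hf ε hε).sub ((isBigO_characteristic_sub_characteristic_inv mf).trans
    (isBigO_one_rpow_atTop (by linarith : 0 ≤ ρ + ε)))
  refine h.congr_left fun r => by simp

/-- A meromorphic function on the plane that vanishes identically near a point vanishes off a
closed discrete set. -/
lemma eventuallyEq_zero_codiscrete (mf : Meromorphic f) {z : ℂ} (h : meromorphicOrderAt f z = ⊤) :
    f =ᶠ[codiscrete ℂ] 0 := by
  have h1 : ∀ w, meromorphicOrderAt f w = ⊤ := by
    intro w
    by_contra hw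
    exact MeromorphicOn.meromorphicOrderAt_ne_top_of_isPreconnected (U := Set.univ)
      mf.meromorphicOn isPreconnected_univ (Set.mem_univ w) (Set.mem_univ z) hw h
  change {w | f w = 0} ∈ codiscrete ℂ
  rw [mem_codiscrete]
  intro w
  rw [Filter.disjoint_principal_right, compl_compl]
  exact meromorphicOrderAt_eq_top_iff.1 (h1 w)

lemma hasOrderLE_zero : HasOrderLE 0 ρ := by
  have h : characteristic (0 : ℂ → ℂ) ⊤ = 0 := by
    funext r
    have h1 : MeromorphicOn.divisor (0 : ℂ → ℂ) Set.univ = 0 :=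
      MeromorphicOn.divisor_const (0 : ℂ)
    have h2 : Real.circleAverage (fun _ : ℂ => (0 : ℝ)) 0 r = 0 := Real.circleAverage_const _ _ _
    simpa [characteristic, proximity_top, logCounting_top, h1] using h2
  intro ε hε
  rw [h]
  exact isBigO_zero _ _

lemma HasOrderLE.mul (mf : Meromorphic f) (mg : Meromorphic g)
    (hf : HasOrderLE f ρ) (hg : HasOrderLE g ρ) : HasOrderLE (f * g) ρ := by
  by_cases h1 : ∃ z, meromorphicOrderAt f z = ⊤
  · obtain ⟨z, hz⟩ := h1
    refine hasOrderLE_zero.congr ?_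
    filter_upwards [eventuallyEq_zero_codiscrete mf hz] with w hw
    simp [hw]
  by_cases h2 : ∃ z, meromorphicOrderAt g z = ⊤
  · obtain ⟨z, hz⟩ := h2
    refine hasOrderLE_zero.congr ?_
    filter_upwards [eventuallyEq_zero_codiscrete mg hz] with w hw
    simp [hw]
  push Not at h1 h2
  exact hasOrderLE_of_characteristic_le (characteristic_mul_top_eventuallyLE mf h1 mg h2)
    fun ε hε => (hf ε hε).add (hg ε hε)

lemma HasOrderLE.div (mf : Meromorphic f) (mg : Meromorphic g) (hρ : 0 ≤ ρ)
    (hf : HasOrderLE f ρ) (hg : HasOrderLE g ρ) : HasOrderLE (f / g) ρ := by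
  rw [div_eq_mul_inv]
  exact HasOrderLE.mul mf mg.inv hf (hg.inv mg hρ)

lemma logCounting_top_of_differentiable (hf : Differentiable ℂ f) : logCounting f ⊤ = 0 := by
  have h : (MeromorphicOn.divisor f Set.univ)⁻ = 0 := by
    rw [negPart_eq_zero]
    exact MeromorphicOn.AnalyticOnNhd.divisor_nonneg
      (Complex.analyticOnNhd_univ_iff_differentiable.2 hf)
  simp [logCounting_top, h]

lemma meromorphic_of_differentiable (hf : Differentiable ℂ f) : Meromorphic f :=
  fun z => (hf.analyticAt z).meromorphicAt

lemma characteristic_top_of_differentiable (hf : Differentiable ℂ f) :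
    characteristic f ⊤ = Real.circleAverage (fun z => Real.posLog ‖f z‖) 0 := by
  simp [characteristic, logCounting_top_of_differentiable hf, proximity_top]

/-- For an entire function, the characteristic is bounded by the logarithm of the maximum
modulus. -/
lemma characteristic_top_le_of_norm_le (hf : Differentiable ℂ f) {r M : ℝ} (hM : 0 ≤ M)
    (h : ∀ z, ‖z‖ = |r| → ‖f z‖ ≤ Real.exp M) : characteristic f ⊤ r ≤ M := by
  rw [characteristic_top_of_differentiable hf]
  refine Real.circleAverage_mono_on_of_le_circle ?_ fun z hz => ?_
  · exact (meromorphic_of_differentiable hf).meromorphicOn.circleIntegrable_posLog_norm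
  · have h1 := Real.posLog_le_posLog (norm_nonneg (f z)) (h z (by simpa using hz))
    refine h1.trans (le_of_eq ?_)
    rw [Real.posLog_apply, Real.log_exp, max_eq_right hM]

lemma hasOrderLE_of_norm_le (hf : Differentiable ℂ f)
    (h : ∀ ε : ℝ, 0 < ε → ∃ C R : ℝ, ∀ z, R ≤ ‖z‖ → ‖f z‖ ≤ Real.exp (C * ‖z‖ ^ (ρ + ε))) :
    HasOrderLE f ρ := by
  intro ε hε
  obtain ⟨C, R, hC⟩ := h ε hε
  refine (isBigO_of_eventually_le characteristic_eventually_nonneg (g := fun r => |C| * r ^ (ρ + ε))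
    ?_).trans (isBigO_const_mul_self _ _ _)
  filter_upwards [eventually_ge_atTop R, eventually_ge_atTop 0] with r hr hr0
  refine characteristic_top_le_of_norm_le hf (by positivity) fun z hz => ?_
  rw [abs_of_nonneg hr0] at hz
  refine (hC z (hz ▸ hr)).trans (Real.exp_le_exp.2 ?_)
  rw [hz]
  gcongr
  exact le_abs_self C

lemma hasOrderLE_const (c : ℂ) (hρ : 0 ≤ ρ) : HasOrderLE (fun _ => c) ρ := by
  refine hasOrderLE_of_norm_le (differentiable_const c) fun ε hε => ⟨‖c‖, 1, fun z hz => ?_⟩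
  have h1 : 1 ≤ ‖z‖ ^ (ρ + ε) := Real.one_le_rpow hz (by linarith)
  have h2 : ‖c‖ * 1 ≤ ‖c‖ * ‖z‖ ^ (ρ + ε) := by gcongr
  have h3 := Real.add_one_le_exp (‖c‖ * ‖z‖ ^ (ρ + ε))
  linarith

lemma hasOrderLE_id (hρ : 0 ≤ ρ) : HasOrderLE (fun z => z) ρ := by
  refine hasOrderLE_of_norm_le differentiable_id fun ε hε => ⟨1 / ε, 1, fun z hz => ?_⟩
  have h0 : 0 < ‖z‖ := by linarith
  have h1 := Real.log_le_rpow_div h0.le hε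
  have h2 : ‖z‖ ^ ε ≤ ‖z‖ ^ (ρ + ε) := Real.rpow_le_rpow_of_exponent_le hz (by linarith)
  calc ‖z‖ = Real.exp (Real.log ‖z‖) := (Real.exp_log h0).symm
    _ ≤ _ := by
      refine Real.exp_le_exp.2 (h1.trans ?_)
      rw [div_mul_eq_mul_div, one_mul]
      gcongr

lemma hasOrderLE_polynomial (p : ℂ[X]) : HasOrderLE (fun z => p.eval z) 0 := by
  have m (q : ℂ[X]) : Meromorphic fun z => q.eval z :=
    meromorphic_of_differentiable q.differentiable
  induction p using Polynomial.induction_on' with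
  | add p q hp hq =>
    refine (HasOrderLE.add (m p) (m q) le_rfl hp hq).congr (Eventually.of_forall fun z => ?_)
    simp
  | monomial n a =>
    have h : ∀ n : ℕ, HasOrderLE (fun z => z ^ n) 0 := by
      intro n
      induction n with
      | zero => simpa using hasOrderLE_const 1 le_rfl
      | succ n ih =>
        have h1 := HasOrderLE.mul (meromorphic_of_differentiable (by fun_prop))
          (meromorphic_of_differentiable differentiable_id) ih (hasOrderLE_id le_rfl)
        refine h1.congr (Eventually.of_forall fun z => ?_)
        simp [pow_succ]
    have h2 := HasOrderLE.mul (meromorphic_of_differentiable (by fun_prop))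
      (meromorphic_of_differentiable (by fun_prop)) (hasOrderLE_const a le_rfl) (h n)
    refine h2.congr (Eventually.of_forall fun z => ?_)
    simp

lemma hasOrderLE_sub_one_zpow (n : ℤ) : HasOrderLE (fun z => (z - 1) ^ n) 0 := by
  have h (k : ℕ) : HasOrderLE (fun z => (z - 1) ^ k) 0 := by
    refine (hasOrderLE_polynomial ((X - C 1) ^ k)).congr (Eventually.of_forall fun z => ?_)
    simp
  obtain ⟨k, rfl | rfl⟩ := n.eq_nat_or_neg
  · simpa using h k
  · have := (h k).inv (meromorphic_of_differentiable (by fun_prop)) le_rfl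
    refine this.congr (Eventually.of_forall fun z => ?_)
    simp

lemma IsRational.hasOrderLE (hf : IsRational f) : HasOrderLE f 0 := by
  obtain ⟨p, q, -, h⟩ := hf
  refine HasOrderLE.congr ?_ h.symm
  exact HasOrderLE.div (meromorphic_of_differentiable p.differentiable)
    (meromorphic_of_differentiable q.differentiable) le_rfl (hasOrderLE_polynomial p)
    (hasOrderLE_polynomial q)

/-! ### Comparison with the order `growthOrder` -/

lemma HasOrderLE.growthOrder_le (hρ : 0 ≤ ρ) (hf : HasOrderLE f ρ) : growthOrder f ≤ ρ := by
  have key : ∀ ε : ℝ, 0 < ε → growthOrder f ≤ ((ρ + ε : ℝ) : EReal) := by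
    intro ε hε
    obtain ⟨C, hC0, hC⟩ := (hf (ε / 2) (by positivity)).exists_pos
    rw [IsBigOWith] at hC
    refine limsup_le_of_le (by isBoundedDefault) ?_
    have hlim : ∀ᶠ r : ℝ in atTop, Real.posLog C ≤ (ε / 2) * Real.log r :=
      (Real.tendsto_log_atTop.const_mul_atTop (by positivity)).eventually_ge_atTop _
    filter_upwards [hC, hlim, eventually_gt_atTop 1] with r h1 h2 h3
    have hr0 : 0 < r := by linarith
    have hlog : 0 < Real.log r := Real.log_pos h3
    rw [EReal.coe_le_coe_iff, div_le_iff₀ hlog]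
    have h4 : Real.posLog (characteristic f ⊤ r) ≤ Real.posLog (C * r ^ (ρ + ε / 2)) := by
      rw [← Real.posLog_abs]
      refine Real.posLog_le_posLog (abs_nonneg _) ?_
      rwa [Real.norm_eq_abs, Real.norm_of_nonneg (by positivity)] at h1
    have h5 : Real.posLog (r ^ (ρ + ε / 2)) = (ρ + ε / 2) * Real.log r := by
      rw [Real.posLog_apply, Real.log_rpow hr0, max_eq_right (by positivity)]
    have h6 := Real.posLog_mul (x := C) (y := r ^ (ρ + ε / 2))
    nlinarith
  refine EReal.le_of_forall_lt_iff_le.1 fun z hz => ?_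
  have := key (z - ρ) (by have := EReal.coe_lt_coe_iff.1 hz; linarith)
  simpa using this

lemma le_growthOrder_of_eventually_le {c : ℝ} (hc : 0 < c)
    (h : ∀ᶠ r in atTop, c * r ^ ρ ≤ characteristic f ⊤ r) : (ρ : EReal) ≤ growthOrder f := by
  refine EReal.ge_of_forall_gt_iff_ge.1 fun z hz => ?_
  have hz' : z < ρ := EReal.coe_lt_coe_iff.1 hz
  refine le_limsup_of_frequently_le (Eventually.frequently ?_) (by isBoundedDefault)
  have hlim : ∀ᶠ r : ℝ in atTop, -Real.log c ≤ (ρ - z) * Real.log r :=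
    (Real.tendsto_log_atTop.const_mul_atTop (by linarith)).eventually_ge_atTop _
  filter_upwards [h, hlim, eventually_gt_atTop 1] with r h1 h2 h3
  have hr0 : 0 < r := by linarith
  have hlog : 0 < Real.log r := Real.log_pos h3
  rw [EReal.coe_le_coe_iff, le_div_iff₀ hlog]
  have h4 : Real.log (c * r ^ ρ) ≤ Real.posLog (characteristic f ⊤ r) := by
    refine le_trans ?_ (le_max_right _ _)
    exact Real.log_le_log (by positivity) h1
  rw [Real.log_mul hc.ne' (by positivity), Real.log_rpow hr0] at h4
  linarith

lemma hasOrderLE_of_growthOrder_lt (hf : growthOrder f < ρ) : HasOrderLE f ρ := by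
  intro ε hε
  have h := eventually_lt_of_limsup_lt hf (by isBoundedDefault)
  refine (isBigO_of_eventually_le characteristic_eventually_nonneg ?_).trans
    (isBigO_rpow_atTop_of_le (by linarith : ρ ≤ ρ + ε))
  filter_upwards [h, eventually_gt_atTop 1] with r h1 h3
  have hr0 : 0 < r := by linarith
  have hlog : 0 < Real.log r := Real.log_pos h3
  rw [EReal.coe_lt_coe_iff, div_lt_iff₀ hlog] at h1
  rcases le_or_gt (characteristic f ⊤ r) 0 with h0 | h0
  · exact h0.trans (by positivity)
  · have h4 : Real.log (characteristic f ⊤ r) ≤ Real.log (r ^ ρ) := by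
      rw [Real.log_rpow hr0]
      exact (le_max_right _ _).trans h1.le
    exact (Real.log_le_log_iff h0 (by positivity)).1 h4

lemma exists_hasOrderLE_of_growthOrder_ne_top (hf : growthOrder f ≠ ⊤) :
    ∃ k : ℕ, HasOrderLE f k := by
  obtain ⟨x, hx, -⟩ := EReal.lt_iff_exists_real_btwn.1 (lt_top_iff_ne_top.2 hf)
  obtain ⟨k, hk⟩ := exists_nat_gt x
  exact ⟨k, hasOrderLE_of_growthOrder_lt (hx.trans (EReal.coe_lt_coe_iff.2 hk))⟩

end MovingTarget

/-! ### Zero-free entire functions of finite order -/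

namespace MovingTarget

open ValueDistribution Asymptotics Topology Real Complex

lemma isLittleO_rpow_atTop_of_lt {a b : ℝ} (h : a < b) :
    (fun r : ℝ => r ^ a) =o[atTop] fun r : ℝ => r ^ b := by
  have h1 : (fun _ : ℝ => (1 : ℝ)) =o[atTop] fun r : ℝ => r ^ (b - a) :=
    isLittleO_const_left.2 (Or.inr (tendsto_norm_atTop_atTop.comp
      (tendsto_rpow_atTop (sub_pos.2 h))))
  refine ((isBigO_refl (fun r : ℝ => r ^ a) atTop).mul_isLittleO h1).congr' ?_ ?_
  · simp
  · filter_upwards [eventually_gt_atTop 0] with r hr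
    rw [← Real.rpow_add hr]
    congr 1
    ring

lemma norm_circleAverage_le {f : ℂ → ℂ} {c : ℂ} {R : ℝ} :
    ‖circleAverage f c R‖ ≤ circleAverage (fun z => ‖f z‖) c R := by
  rw [circleAverage_def, circleAverage_def, norm_smul, smul_eq_mul,
    Real.norm_of_nonneg (by positivity)]
  gcongr
  exact intervalIntegral.norm_integral_le_integral_norm (by positivity)

variable {g : ℂ → ℂ}

lemma circleAverage_div_pow (hg : Differentiable ℂ g) (n : ℕ) {r : ℝ} (hr : 0 < r) :
    circleAverage (fun z => g z / z ^ n) 0 r = iteratedDeriv n g 0 / n.factorial := by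
  have h := (hg.diffContOnCl (s := Metric.ball 0 r)).circleIntegral_one_div_sub_center_pow_smul hr n
  rw [circleAverage_eq_circleIntegral hr.ne']
  have h2 : (∮ z in C(0, r), (z - 0)⁻¹ • (g z / z ^ n)) =
      ∮ z in C(0, r), (1 / (z - 0) ^ (n + 1)) • g z := by
    congr 1
    funext z
    simp only [sub_zero, smul_eq_mul, pow_succ, one_div, mul_inv]
    ring
  rw [h2, h, smul_smul]
  have : (2 * π * I : ℂ) ≠ 0 := two_pi_I_ne_zero
  rw [div_eq_mul_inv, ← mul_assoc, inv_mul_cancel₀ this, one_mul, smul_eq_mul, div_eq_inv_mul]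

/-- The negative Fourier coefficients of an entire function vanish. -/
lemma circleAverage_conj_div_pow (hg : Differentiable ℂ g) {n : ℕ} (hn : n ≠ 0) {r : ℝ}
    (hr : 0 < r) : circleAverage (fun z => conj (g z) / z ^ n) 0 r = 0 := by
  have hd : Differentiable ℂ fun z => g z * z ^ n := by fun_prop
  have h1 : circleAverage (fun z => g z * z ^ n) 0 r = 0 := by
    rw [(hd.diffContOnCl (s := Metric.ball 0 |r|)).circleAverage]
    simp [hn]
  have h2 := (conjCLE : ℂ ≃L[ℝ] ℂ).toContinuousLinearMap.circleAverage_comp_comm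
    (hd.continuous.continuousOn.circleIntegrable (c := 0) hr.le)
  rw [h1, map_zero] at h2
  have h3 : circleAverage (fun z => conj (g z) / z ^ n) 0 r =
      circleAverage (fun z => ((r : ℂ) ^ (2 * n))⁻¹ • (conjCLE : ℂ ≃L[ℝ] ℂ) (g z * z ^ n)) 0 r := by
    -- `1 / z = conj z / r ^ 2` on the circle
    refine circleAverage_congr_sphere fun z hz => ?_
    have hz' : ‖z‖ = r := by simpa [abs_of_pos hr] using hz
    have hz0 : z ≠ 0 := norm_pos_iff.1 (hz' ▸ hr)
    have h4 : z * conj z = (r : ℂ) ^ 2 := by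
      rw [Complex.mul_conj, Complex.normSq_eq_norm_sq, hz']
      simp
    have hr' : (r : ℂ) ≠ 0 := by exact_mod_cast hr.ne'
    have hc : conj z ≠ 0 := by simpa using hz0
    simp only [conjCLE_apply, map_mul, map_pow, smul_eq_mul]
    rw [pow_mul, ← h4, mul_pow]
    field_simp
  rw [h3]
  have h5 := circleAverage_fun_smul (a := ((r : ℂ) ^ (2 * n))⁻¹) (c := 0) (R := r)
    (f := fun z => (conjCLE : ℂ ≃L[ℝ] ℂ) (g z * z ^ n))
  rw [h5]
  have h6 : circleAverage (fun z => (conjCLE : ℂ ≃L[ℝ] ℂ) (g z * z ^ n)) 0 r = 0 := h2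
  rw [h6, smul_zero]

/-- The Taylor coefficients of an entire function are controlled by the mean of the absolute value
of its real part: the conjugate of `g` contributes nothing to the Fourier coefficients of positive
index, so that `g` may be replaced by `g + conj g`. -/
lemma norm_taylorCoeff_mul_pow_le (hg : Differentiable ℂ g) {n : ℕ} (hn : n ≠ 0) {r : ℝ}
    (hr : 0 < r) : ‖iteratedDeriv n g 0 / n.factorial‖ * r ^ n ≤
      2 * circleAverage (fun z => |(g z).re|) 0 r := by
  have hne : ∀ z ∈ Metric.sphere (0 : ℂ) r, z ^ n ≠ 0 := by
    intro z hz
    have hz' : ‖z‖ = r := by simpa using hz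
    exact pow_ne_zero _ (norm_pos_iff.1 (hz' ▸ hr))
  have i1 : CircleIntegrable (fun z => g z / z ^ n) 0 r :=
    ContinuousOn.circleIntegrable hr.le (hg.continuous.continuousOn.div (by fun_prop) hne)
  have i2 : CircleIntegrable (fun z => conj (g z) / z ^ n) 0 r :=
    ContinuousOn.circleIntegrable hr.le
      ((Complex.continuous_conj.comp hg.continuous).continuousOn.div (by fun_prop) hne)
  have h1 : iteratedDeriv n g 0 / n.factorial =
      circleAverage (fun z => g z / z ^ n + conj (g z) / z ^ n) 0 r := by
    rw [circleAverage_fun_add i1 i2, circleAverage_conj_div_pow hg hn hr, add_zero,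
      circleAverage_div_pow hg n hr]
  have h2 : circleAverage (fun z => ‖g z / z ^ n + conj (g z) / z ^ n‖) 0 r =
      circleAverage (fun z => (2 / r ^ n) • |(g z).re|) 0 r := by
    refine circleAverage_congr_sphere fun z hz => ?_
    have hz' : ‖z‖ = r := by simpa [abs_of_pos hr] using hz
    simp only [← add_div, Complex.add_conj, norm_div, norm_pow, hz', Complex.norm_real, smul_eq_mul,
      Real.norm_eq_abs, abs_mul, abs_two]
    ring
  have h3 := norm_circleAverage_le (c := 0) (R := r)
    (f := fun z => g z / z ^ n + conj (g z) / z ^ n)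
  rw [← h1, h2, circleAverage_fun_smul, smul_eq_mul] at h3
  calc _ ≤ (2 / r ^ n * circleAverage (fun z => |(g z).re|) 0 r) * r ^ n := by gcongr
    _ = _ := by field_simp

/-- The characteristic of `exp g` controls the mean of `|re g|`, since `|x| = 2 max x 0 - x` and the
mean of `re g` is `re (g 0)`. -/
lemma norm_taylorCoeff_mul_pow_le_characteristic (hg : Differentiable ℂ g) {n : ℕ} (hn : n ≠ 0)
    {r : ℝ} (hr : 0 < r) : ‖iteratedDeriv n g 0 / n.factorial‖ * r ^ n ≤
      4 * characteristic (fun z => exp (g z)) ⊤ r + 2 * |(g 0).re| := by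
  refine (norm_taylorCoeff_mul_pow_le hg hn hr).trans ?_
  have hc : Continuous fun z => (g z).re := Complex.continuous_re.comp hg.continuous
  have i1 : CircleIntegrable (fun z => (g z).re) 0 r := hc.continuousOn.circleIntegrable hr.le
  have i2 : CircleIntegrable (fun z => (2 : ℝ) • log⁺ ‖exp (g z)‖) 0 r := by
    refine ContinuousOn.circleIntegrable hr.le (Continuous.continuousOn ?_)
    have := hg.continuous
    fun_prop
  have h1 : circleAverage (fun z => (g z).re) 0 r = (g 0).re := by
    have := (Complex.reCLM).circleAverage_comp_comm
      (hg.continuous.continuousOn.circleIntegrable (c := 0) hr.le)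
    rw [(hg.diffContOnCl (s := Metric.ball 0 |r|)).circleAverage] at this
    exact this
  have h2 : circleAverage (fun z => |(g z).re|) 0 r =
      circleAverage (fun z => (2 : ℝ) • log⁺ ‖exp (g z)‖ - (g z).re) 0 r := by
    refine circleAverage_congr_sphere fun z _ => ?_
    simp only [Complex.norm_exp, Real.posLog_apply, Real.log_exp, smul_eq_mul]
    rcases le_total 0 (g z).re with h | h
    · rw [abs_of_nonneg h, max_eq_right h]; ring
    · rw [abs_of_nonpos h, max_eq_left h]; ring
  rw [h2, circleAverage_fun_sub i2 i1, h1, circleAverage_fun_smul,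
    characteristic_top_of_differentiable (by fun_prop), smul_eq_mul]
  have := neg_abs_le (g 0).re
  linarith

lemma exists_exp_eq_of_ne_zero {E : ℂ → ℂ} (hE : Differentiable ℂ E) (h0 : ∀ z, E z ≠ 0) :
    ∃ g : ℂ → ℂ, Differentiable ℂ g ∧ ∀ z, E z = exp (g z) := by
  have hd : Differentiable ℂ fun z => deriv E z / E z :=
    (hE.contDiff (n := 2)).differentiable_deriv_two.div hE h0
  obtain ⟨g, hg0, hg⟩ := hd.isExactOn_univ.with_val_at 0 (Complex.log (E 0))
  have hg' (z : ℂ) : HasDerivAt g (deriv E z / E z) z := hg z (Set.mem_univ z)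
  refine ⟨g, fun z => (hg' z).differentiableAt, fun z => ?_⟩
  have hq (z : ℂ) : HasDerivAt (fun z => E z * exp (-g z)) 0 z := by
    refine ((hE z).hasDerivAt.mul (hg' z).neg.cexp).congr_deriv ?_
    have := h0 z
    field_simp
    ring
  have hconst := is_const_of_deriv_eq_zero (fun z => (hq z).differentiableAt)
    (fun z => (hq z).deriv) z 0
  simp only [hg0, Complex.exp_neg, Complex.exp_log (h0 0)] at hconst
  rw [mul_inv_cancel₀ (h0 0)] at hconst
  field_simp at hconst
  exact hconst

/-- If `exp g` has finite order then `g` is a polynomial: all but finitely many of its Taylor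
coefficients vanish. -/
lemma exists_polynomial_of_hasOrderLE_exp (hg : Differentiable ℂ g) {ρ : ℝ}
    (h : HasOrderLE (fun z => exp (g z)) ρ) : ∃ p : ℂ[X], ∀ z, g z = p.eval z := by
  obtain ⟨k, hk⟩ := exists_nat_gt (max ρ 0)
  have hk0 : 0 < k := by exact_mod_cast (le_max_right ρ 0).trans_lt hk
  have hzero : ∀ n, k ≤ n → iteratedDeriv n g 0 / (n.factorial : ℂ) = 0 := by
    intro n hn
    obtain ⟨ε, hε, hρε⟩ : ∃ ε > 0, ρ + ε < n := by
      have : ρ < n := (le_max_left ρ 0).trans_lt (hk.trans_le (by exact_mod_cast hn))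
      exact ⟨(n - ρ) / 2, by linarith, by linarith⟩
    have h1 : (fun r : ℝ => r ^ (ρ + ε)) =o[atTop] fun r : ℝ => r ^ (n : ℝ) :=
      isLittleO_rpow_atTop_of_lt hρε
    have h2 : (fun _ : ℝ => 2 * |(g 0).re|) =o[atTop] fun r : ℝ => r ^ (n : ℝ) := by
      refine isLittleO_const_left.2 (Or.inr ?_)
      refine tendsto_norm_atTop_atTop.comp (tendsto_rpow_atTop ?_)
      exact_mod_cast lt_of_lt_of_le hk0 hn
    have h3 := (((h ε hε).trans_isLittleO h1).const_mul_left 4).add h2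
    by_contra hne
    have hc : 0 < ‖iteratedDeriv n g 0 / (n.factorial : ℂ)‖ := norm_pos_iff.2 hne
    have h4 := h3.def (half_pos hc)
    obtain ⟨r, hr1, hr⟩ := (h4.and (eventually_gt_atTop 0)).exists
    have h5 := norm_taylorCoeff_mul_pow_le_characteristic hg (n := n) (by omega) hr
    rw [Real.rpow_natCast, Real.norm_of_nonneg (pow_nonneg hr.le n), Real.norm_eq_abs] at hr1
    have h6 := (le_abs_self _).trans hr1
    have h7 := mul_pos hc (pow_pos hr n)
    linarith
  refine ⟨∑ n ∈ Finset.range k, C (iteratedDeriv n g 0 / (n.factorial : ℂ)) * X ^ n, fun z => ?_⟩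
  rw [← Complex.taylorSeries_eq_of_entire' 0 z hg, tsum_eq_sum (s := Finset.range k)]
  · simp [Polynomial.eval_finsetSum, div_eq_inv_mul]
  · intro n hn
    have := hzero n (by simpa using hn)
    rw [div_eq_inv_mul] at this
    rw [this, zero_mul]

/-- The characteristic of `exp p` grows at least like the degree of `p`. -/
lemma le_characteristic_exp_polynomial (p : ℂ[X]) (hp : p.natDegree ≠ 0) :
    ∃ c > 0, ∀ᶠ r in atTop,
      c * r ^ (p.natDegree : ℝ) ≤ characteristic (fun z => exp (p.eval z)) ⊤ r := by
  set d := p.natDegree with hd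
  have hcoeff : iteratedDeriv d (fun z => p.eval z) 0 / (d.factorial : ℂ) = p.leadingCoeff := by
    have h1 : iteratedDeriv d (fun z => p.eval z) = fun z => (derivative^[d] p).eval z := by
      rw [iteratedDeriv_eq_iterate]
      clear_value d
      clear hd hp
      induction d generalizing p with
      | zero => rfl
      | succ n ih =>
        rw [Function.iterate_succ_apply, Function.iterate_succ_apply]
        have : deriv (fun z => p.eval z) = fun z => (derivative p).eval z := by
          funext z; exact p.deriv
        rw [this, ih]
    rw [h1]
    change ((derivative^[d] p).eval 0) / (d.factorial : ℂ) = _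
    rw [← coeff_zero_eq_eval_zero, coeff_iterate_derivative, zero_add, Nat.descFactorial_self,
      nsmul_eq_mul, mul_div_cancel_left₀ _ (by exact_mod_cast d.factorial_ne_zero)]
    rfl
  have hlead : 0 < ‖p.leadingCoeff‖ := by
    rw [norm_pos_iff, ne_eq, leadingCoeff_eq_zero]
    rintro rfl
    simp [hd] at hp
  refine ⟨‖p.leadingCoeff‖ / 8, by positivity, ?_⟩
  have hlim : ∀ᶠ r : ℝ in atTop, 4 * |(p.eval 0).re| ≤ ‖p.leadingCoeff‖ * r ^ d :=
    ((tendsto_pow_atTop hp).const_mul_atTop hlead).eventually_ge_atTop _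
  filter_upwards [hlim, eventually_gt_atTop 0] with r h1 h2
  have h3 := norm_taylorCoeff_mul_pow_le_characteristic p.differentiable hp h2
  rw [hcoeff] at h3
  rw [Real.rpow_natCast]
  linarith

lemma HasOrderLE.natDegree_le {p : ℂ[X]} {ρ : ℝ} (hρ : 0 ≤ ρ)
    (h : HasOrderLE (fun z => exp (p.eval z)) ρ) : (p.natDegree : ℝ) ≤ ρ := by
  by_contra! hlt
  have hp : p.natDegree ≠ 0 := by
    intro h0
    rw [h0] at hlt
    exact absurd hρ (by simpa using hlt)
  obtain ⟨c, hc, hle⟩ := le_characteristic_exp_polynomial p hp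
  have h1 := (h ((p.natDegree - ρ) / 2) (by linarith)).trans_isLittleO
    (isLittleO_rpow_atTop_of_lt (by linarith : ρ + (p.natDegree - ρ) / 2 < (p.natDegree : ℝ)))
  obtain ⟨r, h2, h3, h4⟩ := ((h1.def (half_pos hc)).and (hle.and (eventually_gt_atTop 0))).exists
  have h5 : 0 < r ^ (p.natDegree : ℝ) := by positivity
  rw [Real.norm_of_nonneg h5.le] at h2
  have := (le_abs_self _).trans h2
  nlinarith

lemma isBigO_characteristic_exp_polynomial (p : ℂ[X]) :
    characteristic (fun z => exp (p.eval z)) ⊤ =O[atTop] fun r : ℝ => r ^ (p.natDegree : ℝ) := by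
  set S := ∑ i ∈ Finset.range (p.natDegree + 1), ‖p.coeff i‖ with hS
  have hS0 : 0 ≤ S := Finset.sum_nonneg fun _ _ => norm_nonneg _
  refine (isBigO_of_eventually_le characteristic_eventually_nonneg
    (g := fun r => S * r ^ (p.natDegree : ℝ)) ?_).trans (isBigO_const_mul_self _ _ _)
  filter_upwards [eventually_ge_atTop 1] with r hr
  have hd : Differentiable ℂ fun z => exp (p.eval z) := p.differentiable.cexp
  refine characteristic_top_le_of_norm_le hd (by positivity) fun z hz => ?_
  rw [Complex.norm_exp]
  refine Real.exp_le_exp.2 ((Complex.re_le_norm _).trans ?_)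
  rw [eval_eq_sum_range, hS, Finset.sum_mul, Real.rpow_natCast]
  refine norm_sum_le_of_le _ fun i hi => ?_
  rw [norm_mul, norm_pow, hz, abs_of_nonneg (by linarith)]
  gcongr
  simpa [Nat.lt_succ_iff] using hi

lemma hasOrderLE_exp_polynomial (p : ℂ[X]) :
    HasOrderLE (fun z => exp (p.eval z)) p.natDegree := fun _ hε =>
  (isBigO_characteristic_exp_polynomial p).trans (isBigO_rpow_atTop_of_le (by linarith))

end MovingTarget

/-! ### Growth of the Gamma function -/

namespace MovingTarget

open Asymptotics Topology Complex

lemma norm_Gamma_le {w : ℂ} (hw : 0 < w.re) : ‖Gamma w‖ ≤ Real.Gamma w.re := by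
  rw [Complex.Gamma_eq_integral hw, Real.Gamma_eq_integral hw, Complex.GammaIntegral]
  refine (MeasureTheory.norm_integral_le_integral_norm _).trans (le_of_eq ?_)
  refine MeasureTheory.setIntegral_congr_fun measurableSet_Ioi fun x hx => ?_
  have hx' : 0 < x := hx
  simp [Complex.norm_cpow_eq_rpow_re_of_pos hx', Complex.norm_exp]

/-- For fixed imaginary part, `‖Γ (x + i y)‖ / Γ x` increases with `x`: this is visible on each
factor of the Euler products `GammaSeq`. -/
lemma Gamma_mul_norm_Gamma_le {x : ℝ} (hx : 1 ≤ x) (y : ℝ) :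
    Real.Gamma x * ‖Gamma (1 + y * I)‖ ≤ ‖Gamma (x + y * I)‖ := by
  have key : ∀ n : ℕ, n ≠ 0 → Real.GammaSeq x n * ‖GammaSeq (1 + y * I) n‖ ≤
      ‖GammaSeq (x + y * I) n‖ * Real.GammaSeq 1 n := by
    intro n hn
    have hn' : (0 : ℝ) < n := by exact_mod_cast Nat.pos_of_ne_zero hn
    have hnorm : ∀ a : ℝ, ‖GammaSeq (a + y * I) n‖ =
        (n : ℝ) ^ a * n.factorial / ∏ j ∈ Finset.range (n + 1), ‖(a : ℂ) + y * I + j‖ := by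
      intro a
      rw [GammaSeq, norm_div, norm_mul, norm_prod, Complex.norm_natCast]
      congr 2
      have := Complex.norm_cpow_eq_rpow_re_of_pos hn' (a + y * I)
      simpa using this
    have h1 := hnorm 1
    rw [Complex.ofReal_one] at h1
    rw [h1, hnorm x, Real.GammaSeq, Real.GammaSeq]
    have hpos : ∀ a : ℝ, 1 ≤ a → ∀ j : ℕ, 0 < ‖(a : ℂ) + y * I + j‖ := by
      intro a ha j
      rw [norm_pos_iff]
      intro h
      have := congrArg Complex.re h
      simp at this
      have : (0 : ℝ) ≤ j := Nat.cast_nonneg j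
      linarith
    have hp1 := Finset.prod_pos fun j (_ : j ∈ Finset.range (n + 1)) => hpos x hx j
    have hp2 := Finset.prod_pos fun j (_ : j ∈ Finset.range (n + 1)) => hpos 1 le_rfl j
    have hp3 : 0 < ∏ j ∈ Finset.range (n + 1), (x + (j : ℝ)) :=
      Finset.prod_pos fun j _ => by positivity
    have hp4 : 0 < ∏ j ∈ Finset.range (n + 1), (1 + (j : ℝ)) :=
      Finset.prod_pos fun j _ => by positivity
    rw [Complex.ofReal_one] at hp2
    rw [div_mul_div_comm, div_mul_div_comm]
    refine div_le_div_of_nonneg_left (by positivity) (by positivity) ?_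
    rw [← Finset.prod_mul_distrib, ← Finset.prod_mul_distrib]
    refine Finset.prod_le_prod (fun j _ => by positivity) fun j _ => ?_
    have e : ∀ a : ℝ, (a : ℂ) + y * I + j = ((a + j : ℝ) : ℂ) + (y : ℂ) * I := by
      intro a; push_cast; ring
    have e1 := e 1
    rw [Complex.ofReal_one] at e1
    rw [e, e1, Complex.norm_add_mul_I, Complex.norm_add_mul_I]
    refine le_of_sq_le_sq ?_ (by positivity)
    rw [mul_pow, mul_pow, Real.sq_sqrt (by positivity), Real.sq_sqrt (by positivity)]
    have h2 : (1 + (j : ℝ)) ^ 2 ≤ (x + j) ^ 2 := by gcongr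
    nlinarith [mul_le_mul_of_nonneg_right h2 (sq_nonneg y)]
  have t1 := (Real.GammaSeq_tendsto_Gamma x).mul (GammaSeq_tendsto_Gamma (1 + y * I)).norm
  have t2 := (GammaSeq_tendsto_Gamma (x + y * I)).norm.mul (Real.GammaSeq_tendsto_Gamma 1)
  rw [Real.Gamma_one, mul_one] at t2
  exact le_of_tendsto_of_tendsto t1 t2 ((eventually_ne_atTop 0).mono key)

lemma sinh_le_mul_exp {t : ℝ} : Real.sinh t ≤ t * Real.exp t := by
  rw [Real.sinh_eq]
  have h := Real.add_one_le_exp (-(2 * t))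
  have h2 : Real.exp (-t) = Real.exp t * Real.exp (-(2 * t)) := by
    rw [← Real.exp_add]
    congr 1
    ring
  rw [h2]
  nlinarith [Real.exp_pos t]

/-- A lower bound on the line `re w = 1`, where the reflection formula evaluates `‖Γ w‖ ^ 2` as
`π y / sinh (π y)`. -/
lemma exp_neg_le_norm_Gamma_one_add (y : ℝ) : Real.exp (-(2 * |y|)) ≤ ‖Gamma (1 + y * I)‖ := by
  rcases eq_or_ne y 0 with rfl | hy
  · simp
  have hyI : (y : ℂ) * I ≠ 0 := by simpa using hy
  have h1 : Gamma (1 + y * I) * Gamma (1 - y * I) =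
      y * I * (Real.pi / Complex.sin (Real.pi * (y * I))) := by
    rw [← Complex.Gamma_mul_Gamma_one_sub, add_comm, Complex.Gamma_add_one _ hyI]
    ring
  have h2 : ‖Gamma (1 - y * I)‖ = ‖Gamma (1 + y * I)‖ := by
    have : (1 - y * I : ℂ) = conj (1 + y * I : ℂ) := by simp [sub_eq_add_neg]
    rw [this, Complex.Gamma_conj, Complex.norm_conj]
  have h3 : Complex.sin (Real.pi * (y * I)) = ((Real.sinh (Real.pi * y) : ℝ) : ℂ) * I := by
    rw [← mul_assoc, Complex.sin_mul_I]
    push_cast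
    rfl
  have h4 : ‖Gamma (1 + y * I)‖ ^ 2 = |y| * (Real.pi / Real.sinh (Real.pi * |y|)) := by
    have h5 := congrArg norm h1
    rw [norm_mul, h2, h3] at h5
    have h6 : |Real.sinh (Real.pi * y)| = Real.sinh (Real.pi * |y|) := by
      rw [Real.abs_sinh, abs_mul, abs_of_pos Real.pi_pos]
    rw [sq, h5]
    simp only [norm_mul, norm_div, Complex.norm_I, Complex.norm_real, Real.norm_eq_abs, mul_one, h6,
      abs_of_pos Real.pi_pos]
  have hpos : 0 < Real.pi * |y| := by positivity
  have hs : 0 < Real.sinh (Real.pi * |y|) := Real.sinh_pos_iff.2 hpos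
  refine le_of_sq_le_sq ?_ (norm_nonneg _)
  rw [h4, ← Real.exp_nat_mul, ← mul_div_assoc, le_div_iff₀ hs]
  have h7 := sinh_le_mul_exp (t := Real.pi * |y|)
  have h8 : Real.exp (((2 : ℕ) : ℝ) * -(2 * |y|)) * Real.exp (Real.pi * |y|) ≤ 1 := by
    rw [← Real.exp_add, Real.exp_le_one_iff]
    push_cast
    nlinarith [Real.pi_le_four, abs_nonneg y]
  calc _ ≤ Real.exp (((2 : ℕ) : ℝ) * -(2 * |y|)) * (Real.pi * |y| * Real.exp (Real.pi * |y|)) := by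
        gcongr
    _ = Real.pi * |y| * (Real.exp (((2 : ℕ) : ℝ) * -(2 * |y|)) * Real.exp (Real.pi * |y|)) := by
        ring
    _ ≤ Real.pi * |y| * 1 := by gcongr
    _ = _ := by ring

lemma Gamma_re_mul_exp_le_norm_Gamma {w : ℂ} (hw : 1 ≤ w.re) :
    Real.Gamma w.re * Real.exp (-(2 * |w.im|)) ≤ ‖Gamma w‖ := by
  have h := Gamma_mul_norm_Gamma_le hw w.im
  rw [Complex.re_add_im] at h
  refine le_trans ?_ h
  have := Real.Gamma_pos_of_pos (by linarith : 0 < w.re)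
  gcongr
  exact exp_neg_le_norm_Gamma_one_add _

lemma mul_log_le_rpow {y ε : ℝ} (hy : 1 ≤ y) (hε : 0 < ε) :
    y * Real.log y ≤ 1 / ε * y ^ (1 + ε) := by
  have h0 : 0 < y := by linarith
  have := Real.log_le_rpow_div h0.le hε
  rw [Real.rpow_add h0, Real.rpow_one]
  calc y * Real.log y ≤ y * (y ^ ε / ε) := by gcongr
    _ = _ := by ring

lemma Gamma_le_exp {x : ℝ} (hx : 2 ≤ x) : Real.Gamma x ≤ Real.exp ((x + 1) * Real.log (x + 1)) := by
  set n := ⌈x⌉₊ with hn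
  have h1 : x ≤ n := Nat.le_ceil x
  have h2 : (n : ℝ) < x + 1 := Nat.ceil_lt_add_one (by linarith)
  have hmono : Real.Gamma x ≤ Real.Gamma (n + 1) :=
    Real.Gamma_strictMonoOn_Ici.monotoneOn (Set.mem_Ici.2 hx)
      (Set.mem_Ici.2 (by linarith)) (by linarith)
  rw [Real.Gamma_nat_eq_factorial] at hmono
  have h3 : (n.factorial : ℝ) ≤ (n : ℝ) ^ n := by exact_mod_cast Nat.factorial_le_pow n
  have hn0 : (0 : ℝ) < n := by linarith
  refine hmono.trans (h3.trans ?_)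
  rw [← Real.exp_log (pow_pos hn0 n), Real.log_pow]
  refine Real.exp_le_exp.2 ?_
  have : 0 ≤ Real.log n := Real.log_nonneg (by linarith)
  have h4 : Real.log n ≤ Real.log (x + 1) := Real.log_le_log hn0 h2.le
  nlinarith

/-- The Gamma function is of order one in the right half-planes `δ ≤ re w`, `δ > 0`. -/
lemma exists_norm_Gamma_le_exp {δ ε : ℝ} (hδ : 0 < δ) (hε : 0 < ε) : ∃ C : ℝ, ∀ w : ℂ, δ ≤ w.re →
    ‖Gamma w‖ ≤ Real.exp (C * (1 + ‖w‖) ^ (1 + ε)) := by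
  refine ⟨1 / ε * 3 ^ (1 + ε) + (δ * δ)⁻¹, fun w hw => ?_⟩
  have hre : 0 < w.re := by linarith
  have hn := norm_nonneg w
  have hle := Complex.re_le_norm w
  have h1 : (1 : ℝ) ≤ (1 + ‖w‖) ^ (1 + ε) := Real.one_le_rpow (by linarith) (by linarith)
  have h2 : Real.Gamma w.re = Real.Gamma (w.re + 2) / (w.re * (w.re + 1)) := by
    rw [show w.re + 2 = w.re + 1 + 1 by ring, Real.Gamma_add_one (by linarith),
      Real.Gamma_add_one (by linarith)]
    field_simp
  have h3 : Real.Gamma (w.re + 2) ≤ Real.exp (1 / ε * 3 ^ (1 + ε) * (1 + ‖w‖) ^ (1 + ε)) := by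
    refine (Gamma_le_exp (by linarith)).trans (Real.exp_le_exp.2 ?_)
    have h4 := mul_log_le_rpow (y := 3 * (1 + ‖w‖)) (by linarith) hε
    rw [Real.mul_rpow (by norm_num) (by linarith), ← mul_assoc] at h4
    refine le_trans ?_ h4
    have h5 : 0 ≤ Real.log (w.re + 2 + 1) := Real.log_nonneg (by linarith)
    have h6 : Real.log (w.re + 2 + 1) ≤ Real.log (3 * (1 + ‖w‖)) :=
      Real.log_le_log (by linarith) (by linarith)
    exact mul_le_mul (by linarith) h6 h5 (by linarith)
  have h7 : 0 < δ * δ := by positivity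
  have h8 : δ * δ ≤ w.re * (w.re + 1) := by nlinarith
  refine (norm_Gamma_le hre).trans ?_
  rw [h2, add_mul, Real.exp_add]
  rw [div_eq_mul_inv]
  refine mul_le_mul h3 ?_ (by positivity) (Real.exp_pos _).le
  have h9 : (w.re * (w.re + 1))⁻¹ ≤ (δ * δ)⁻¹ := inv_anti₀ h7 h8
  have h10 : (δ * δ)⁻¹ ≤ (δ * δ)⁻¹ * (1 + ‖w‖) ^ (1 + ε) :=
    le_mul_of_one_le_right (by positivity) h1
  have := Real.add_one_le_exp ((δ * δ)⁻¹ * (1 + ‖w‖) ^ (1 + ε))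
  linarith

lemma inv_Gamma_eq_prod_mul (w : ℂ) (n : ℕ) :
    (Gamma w)⁻¹ = (∏ j ∈ Finset.range n, (w + j)) * (Gamma (w + n))⁻¹ := by
  induction n with
  | zero => simp
  | succ n ih =>
    rw [ih, Finset.prod_range_succ, Complex.one_div_Gamma_eq_self_mul_one_div_Gamma_add_one (w + n)]
    push_cast
    ring_nf

/-- The entire function `1 / Γ` is of order one. -/
lemma exists_norm_inv_Gamma_le_exp {ε : ℝ} (hε : 0 < ε) : ∃ C : ℝ, ∀ w : ℂ,
    ‖(Gamma w)⁻¹‖ ≤ Real.exp (C * (1 + ‖w‖) ^ (1 + ε)) := by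
  refine ⟨1 / ε * 3 ^ (1 + ε) + 2, fun w => ?_⟩
  have hn := norm_nonneg w
  -- move `w` to the half-plane `2 ≤ re w`, where `Γ` is bounded below
  set n := ⌈2 - w.re⌉₊ with hn_def
  have h1 : 2 ≤ (w + n).re := by
    have := Nat.le_ceil (2 - w.re)
    simp only [Complex.add_re, Complex.natCast_re]
    linarith
  have h2 : (n : ℝ) ≤ ‖w‖ + 3 := by
    have h := (abs_le.1 (Complex.abs_re_le_norm w)).1
    rcases le_or_gt (2 - w.re) 0 with h0 | h0
    · rw [hn_def, Nat.ceil_eq_zero.2 h0]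
      push_cast
      linarith
    · have := Nat.ceil_lt_add_one h0.le
      linarith
  have h3 : ‖∏ j ∈ Finset.range n, (w + j)‖ ≤ (2 * ‖w‖ + 3) ^ n := by
    rw [norm_prod]
    calc _ ≤ ∏ _j ∈ Finset.range n, (2 * ‖w‖ + 3) := by
          refine Finset.prod_le_prod (fun _ _ => norm_nonneg _) fun j hj => ?_
          refine (norm_add_le _ _).trans ?_
          rw [Complex.norm_natCast]
          have : (j : ℝ) ≤ n := by exact_mod_cast (Finset.mem_range.1 hj).le
          linarith
      _ = _ := by simp
  have h4 : (2 * ‖w‖ + 3) ^ n ≤ Real.exp (1 / ε * 3 ^ (1 + ε) * (1 + ‖w‖) ^ (1 + ε)) := by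
    have h0 : 0 < 2 * ‖w‖ + 3 := by linarith
    rw [← Real.exp_log (pow_pos h0 n), Real.log_pow]
    refine Real.exp_le_exp.2 ?_
    have h4 := mul_log_le_rpow (y := 3 * (1 + ‖w‖)) (by linarith) hε
    rw [Real.mul_rpow (by norm_num) (by linarith), ← mul_assoc] at h4
    refine le_trans ?_ h4
    have h5 : 0 ≤ Real.log (2 * ‖w‖ + 3) := Real.log_nonneg (by linarith)
    have h6 : Real.log (2 * ‖w‖ + 3) ≤ Real.log (3 * (1 + ‖w‖)) :=
      Real.log_le_log (by linarith) (by linarith)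
    exact mul_le_mul (by linarith) h6 h5 (by linarith)
  have h5 : ‖(Gamma (w + n))⁻¹‖ ≤ Real.exp (2 * (1 + ‖w‖) ^ (1 + ε)) := by
    have h6 := Gamma_re_mul_exp_le_norm_Gamma (w := w + n) (by linarith)
    have h7 : 1 ≤ Real.Gamma (w + n).re := by
      rw [← Real.Gamma_two]
      exact Real.Gamma_strictMonoOn_Ici.monotoneOn (Set.mem_Ici.2 le_rfl) (Set.mem_Ici.2 h1) h1
    have h8 : Real.exp (-(2 * |w.im|)) ≤ ‖Gamma (w + n)‖ := by
      refine le_trans ?_ h6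
      have : (w + n).im = w.im := by simp
      rw [this]
      exact le_mul_of_one_le_left (Real.exp_pos _).le h7
    rw [norm_inv]
    refine (inv_anti₀ (Real.exp_pos _) h8).trans ?_
    rw [← Real.exp_neg, neg_neg]
    refine Real.exp_le_exp.2 ?_
    have h9 : 1 + ‖w‖ ≤ (1 + ‖w‖) ^ (1 + ε) :=
      Real.self_le_rpow_of_one_le (by linarith) (by linarith)
    have := Complex.abs_im_le_norm w
    linarith
  rw [inv_Gamma_eq_prod_mul w n, norm_mul, add_mul, Real.exp_add]
  exact mul_le_mul (h3.trans h4) h5 (norm_nonneg _) (Real.exp_pos _).le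

/-- In the sector `|im w| ≤ re w` the Gamma function outgrows every exponential. -/
lemma exists_exp_le_norm_Gamma {M : ℝ} (hM : 0 ≤ M) : ∃ R : ℝ, ∀ w : ℂ, R ≤ ‖w‖ →
    |w.im| ≤ w.re → Real.exp (M * ‖w‖) ≤ ‖Gamma w‖ := by
  set K := Real.exp (2 * M + 2) with hK
  have hK1 : 1 ≤ K := Real.one_le_exp (by linarith)
  have hlim := (FloorSemiring.tendsto_pow_div_factorial_atTop K).eventually_le_const
    (u := (K ^ 2)⁻¹) (by positivity)
  obtain ⟨N, hN⟩ := eventually_atTop.1 hlim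
  refine ⟨2 * (N + 3), fun w hw hsec => ?_⟩
  have h1 : ‖w‖ ≤ 2 * w.re := by
    have h := Complex.norm_le_abs_re_add_abs_im w
    have h0 : 0 ≤ w.re := (abs_nonneg _).trans hsec
    rw [abs_of_nonneg h0] at h
    linarith
  have h2 : (N : ℝ) + 3 ≤ w.re := by linarith
  have hN0 : (0 : ℝ) ≤ N := Nat.cast_nonneg N
  obtain ⟨m, hm⟩ : ∃ m : ℕ, ⌊w.re⌋₊ = m + 1 := by
    refine Nat.exists_eq_succ_of_ne_zero (Nat.pos_iff_ne_zero.1 ?_)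
    exact Nat.floor_pos.2 (by linarith)
  have h3 : ((m : ℝ) + 1) ≤ w.re := by
    have := Nat.floor_le (by linarith : 0 ≤ w.re)
    rw [hm] at this
    exact_mod_cast this
  have h4 : w.re < (m : ℝ) + 2 := by
    have := Nat.lt_floor_add_one w.re
    rw [hm] at this
    push_cast at this
    linarith
  have hNm : N ≤ m := by
    have : (N : ℝ) < m := by linarith
    exact_mod_cast this.le
  have h5 : K ^ (m + 2) ≤ Real.Gamma w.re := by
    have h6 := hN m hNm
    rw [div_le_iff₀ (by positivity), inv_mul_eq_div, le_div_iff₀ (by positivity), ← pow_add] at h6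
    refine h6.trans ?_
    rw [← Real.Gamma_nat_eq_factorial]
    exact Real.Gamma_strictMonoOn_Ici.monotoneOn (Set.mem_Ici.2 (by linarith))
      (Set.mem_Ici.2 (by linarith)) h3
  have h6 : Real.exp ((2 * M + 2) * w.re) ≤ K ^ (m + 2) := by
    rw [hK, ← Real.exp_nat_mul]
    refine Real.exp_le_exp.2 ?_
    push_cast
    nlinarith
  refine le_trans ?_ (Gamma_re_mul_exp_le_norm_Gamma (by linarith))
  calc Real.exp (M * ‖w‖) ≤ Real.exp ((2 * M + 2) * w.re) * Real.exp (-(2 * |w.im|)) := by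
        rw [← Real.exp_add]
        refine Real.exp_le_exp.2 ?_
        nlinarith
    _ ≤ _ := by
        gcongr
        exact h6.trans h5

/-- For `1 ≤ re w ≤ 2` this is the convexity of `Γ`; the recursion `Γ (w + 1) = w Γ w` carries the
bound to the left, as `|w| ≥ 1` there. -/
lemma norm_Gamma_le_one {w : ℂ} (hre : w.re ≤ 2) (him : 1 ≤ |w.im|) : ‖Gamma w‖ ≤ 1 := by
  have key : ∀ n : ℕ, ∀ w : ℂ, w.re ≤ 2 → 1 ≤ |w.im| → 1 - n ≤ w.re → ‖Gamma w‖ ≤ 1 := by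
    intro n
    induction n with
    | zero =>
      intro w h1 _ h3
      have h3 : 1 ≤ w.re := by simpa using h3
      refine (norm_Gamma_le (by linarith)).trans ?_
      have h := Real.convexOn_Gamma.2 (Set.mem_Ioi.2 one_pos) (Set.mem_Ioi.2 two_pos)
        (by linarith : 0 ≤ 2 - w.re) (by linarith : 0 ≤ w.re - 1) (by ring)
      simp only [smul_eq_mul, Real.Gamma_one, Real.Gamma_two] at h
      have e : (2 - w.re) * 1 + (w.re - 1) * 2 = w.re := by ring
      rw [e] at h
      linarith
    | succ n ih =>
      intro w h1 h2 h3
      push_cast at h3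
      by_cases h : w.re ≤ 1
      · have h0 : w ≠ 0 := by rintro rfl; simp at h2; linarith
        have h4 := ih (w + 1) (by simp; linarith) (by simpa using h2) (by simp; linarith)
        rw [Complex.Gamma_add_one _ h0, norm_mul] at h4
        have h5 : 1 ≤ ‖w‖ := h2.trans (Complex.abs_im_le_norm w)
        exact (le_mul_of_one_le_left (norm_nonneg _) h5).trans h4
      · refine ih w h1 h2 ?_
        have : (0 : ℝ) ≤ n := Nat.cast_nonneg n
        linarith
  obtain ⟨n, hn⟩ := exists_nat_ge (1 - w.re)
  exact key n w hre him (by linarith)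

end MovingTarget

/-! ### Basic properties of L-functions -/

namespace MovingTarget

open Asymptotics Topology Complex

lemma compl_singleton_mem_codiscrete (a : ℂ) : ({a}ᶜ : Set ℂ) ∈ codiscrete ℂ := by
  rw [mem_codiscrete]
  intro w
  rw [Filter.disjoint_principal_right, compl_compl]
  have h : ∀ᶠ z in 𝓝[≠] w, z ≠ a := by
    rcases eq_or_ne w a with rfl | h
    · exact self_mem_nhdsWithin
    · exact (continuousAt_id.eventually_ne h).filter_mono nhdsWithin_le_nhds
  exact h

lemma eventually_nhdsNE_of_codiscrete {p : ℂ → Prop} (h : ∀ᶠ z in codiscrete ℂ, p z) (w : ℂ) :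
    ∀ᶠ z in 𝓝[≠] w, p z := by
  have h' : {z | p z} ∈ codiscrete ℂ := h
  rw [mem_codiscrete] at h'
  have := h' w
  rwa [Filter.disjoint_principal_right, compl_compl] at this

lemma eq_of_eventuallyEq_codiscrete {f g : ℂ → ℂ} (h : f =ᶠ[codiscrete ℂ] g) {w : ℂ}
    (hf : ContinuousAt f w) (hg : ContinuousAt g w) : f w = g w := by
  have h1 := eventually_nhdsNE_of_codiscrete h w
  exact ((hf.eventuallyEq_nhds_iff_eventuallyEq_nhdsNE hg).1 h1).eq_of_nhds

variable {L : ℂ → ℂ} {F : FEData}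

lemma IsLFunction.eventuallyEq_div (hL : IsLFunction L) : ∃ (k : ℕ) (G : ℂ → ℂ),
    IsEntireOfFiniteOrder G ∧ ∀ s, s ≠ 1 → L s = G s / (s - 1) ^ k := by
  obtain ⟨k, G, hG, h⟩ := hL.continuation
  refine ⟨k, G, hG, fun s hs => ?_⟩
  rw [← h s hs, mul_div_cancel_left₀ _ (pow_ne_zero _ (sub_ne_zero.2 hs))]

lemma IsLFunction.differentiableAt (hL : IsLFunction L) {s : ℂ} (hs : s ≠ 1) :
    DifferentiableAt ℂ L s := by
  obtain ⟨k, G, hG, h⟩ := hL.eventuallyEq_div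
  have h1 : (fun s => G s / (s - 1) ^ k) =ᶠ[𝓝 s] L := by
    filter_upwards [continuousAt_id.eventually_ne hs] with z hz
    exact (h z hz).symm
  refine DifferentiableAt.congr_of_eventuallyEq ?_ h1.symm
  exact (hG.1 s).div (by fun_prop) (pow_ne_zero _ (sub_ne_zero.2 hs))

lemma IsLFunction.meromorphic (hL : IsLFunction L) : Meromorphic L := by
  obtain ⟨k, G, hG, h⟩ := hL.eventuallyEq_div
  have h1 : Meromorphic fun s => G s / (s - 1) ^ k :=
    (meromorphic_of_differentiable hG.1).div (meromorphic_of_differentiable (by fun_prop))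
  refine h1.congr_codiscrete ?_
  filter_upwards [compl_singleton_mem_codiscrete 1] with z hz
  exact (h z hz).symm

/-- An L-function tends to `1` exponentially fast as `re s → ∞`, uniformly in `im s`. -/
lemma IsLFunction.exists_norm_sub_one_le (hL : IsLFunction L) : ∃ C : ℝ, 0 ≤ C ∧ ∀ s : ℂ, 2 ≤ s.re →
    ‖L s - 1‖ ≤ C * 2 ^ (-s.re) := by
  obtain ⟨a, ha1, ha, h⟩ := hL.dirichlet_series
  have hsum : ∀ s : ℂ, 2 ≤ s.re → LSeriesSummable a s := by
    intro s hs
    refine LSeriesSummable_of_isBigO_rpow (x := 3 / 2) (by linarith) ?_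
    have := ha (1 / 2) (by norm_num)
    norm_num at this ⊢
    exact this
  have h2 := (hsum 2 (by simp)).norm.hasSum
  refine ⟨4 * ∑' n, ‖LSeries.term a 2 n‖, by positivity, fun s hs => ?_⟩
  have e1 : HasSum (fun n => LSeries.term a s n - if n = 1 then 1 else 0) (L s - 1) := by
    rw [h s (by linarith)]
    exact (hsum s hs).hasSum.sub (hasSum_ite_eq 1 1)
  rw [← e1.tsum_eq]
  refine (tsum_of_norm_bounded (h2.mul_left (4 * 2 ^ (-s.re))) fun n => ?_).trans_eq (by ring)
  rcases Nat.lt_or_ge n 2 with hn | hn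
  · interval_cases n
    · simp
    · simp [LSeries.term, ha1]
      positivity
  · have hn0 : (0 : ℝ) < n := by exact_mod_cast (by omega : 0 < n)
    have hn2 : (2 : ℝ) ≤ n := by exact_mod_cast hn
    rw [if_neg (by omega), sub_zero, LSeries.norm_term_eq, LSeries.norm_term_eq,
      if_neg (by omega), if_neg (by omega)]
    have e2 : ‖a n‖ / (n : ℝ) ^ s.re = ‖a n‖ / (n : ℝ) ^ (2 : ℂ).re * (n : ℝ) ^ (-(s.re - 2)) := by
      rw [div_mul_eq_mul_div, mul_div_assoc, ← Real.rpow_sub hn0, div_eq_mul_inv,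
        ← Real.rpow_neg hn0.le]
      congr 2
      simp
    have e3 : (n : ℝ) ^ (-(s.re - 2)) ≤ 2 ^ (-(s.re - 2)) :=
      Real.rpow_le_rpow_of_nonpos two_pos hn2 (by linarith)
    have e4 : (2 : ℝ) ^ (-(s.re - 2)) = 4 * 2 ^ (-s.re) := by
      rw [show -(s.re - 2) = 2 + -s.re by ring, Real.rpow_add two_pos]
      norm_num
    rw [e2, mul_comm, ← e4]
    gcongr

lemma IsLFunction.exists_norm_le (hL : IsLFunction L) : ∃ C : ℝ, 0 ≤ C ∧ ∀ s : ℂ, 2 ≤ s.re →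
    ‖L s‖ ≤ C := by
  obtain ⟨C, hC0, hC⟩ := hL.exists_norm_sub_one_le
  refine ⟨1 + C, by linarith, fun s hs => ?_⟩
  have h1 := hC s hs
  have h2 : (2 : ℝ) ^ (-s.re) ≤ 1 :=
    Real.rpow_le_one_of_one_le_of_nonpos (by norm_num) (by linarith)
  have h3 := norm_add_le (L s - 1) 1
  rw [sub_add_cancel, norm_one] at h3
  nlinarith

lemma IsLFunction.exists_norm_sub_one_le_of_pos (hL : IsLFunction L) {η : ℝ} (hη : 0 < η) :
    ∃ σ : ℝ, ∀ s : ℂ, σ ≤ s.re → ‖L s - 1‖ ≤ η := by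
  obtain ⟨C, hC0, hC⟩ := hL.exists_norm_sub_one_le
  have hlim : Tendsto (fun x : ℝ => C * (2 : ℝ) ^ (-x)) atTop (𝓝 (C * 0)) := by
    refine Tendsto.const_mul C ?_
    have := tendsto_rpow_atBot_of_base_gt_one 2 (by norm_num)
    exact this.comp tendsto_neg_atTop_atBot
  rw [mul_zero] at hlim
  obtain ⟨σ, hσ⟩ := eventually_atTop.1 (hlim.eventually_le_const hη)
  exact ⟨max σ 2, fun s hs => (hC s ((le_max_right _ _).trans hs)).trans
    (hσ _ ((le_max_left _ _).trans hs))⟩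

/-! ### The functional equation as a pointwise identity -/

/-- The entire function `∏ⱼ 1 / Γ(λⱼ s + μⱼ)`. -/
noncomputable def FEData.invGamma (F : FEData) (s : ℂ) : ℂ :=
  ∏ j, (Gamma ((F.lam j : ℂ) * s + F.mu j))⁻¹

/-- The entire function `∏ⱼ 1 / Γ(λⱼ (1 - s) + conj μⱼ)`, the reflection of `FEData.invGamma`. -/
noncomputable def FEData.invGammaDual (F : FEData) (s : ℂ) : ℂ :=
  ∏ j, (Gamma ((F.lam j : ℂ) * (1 - s) + conj (F.mu j)))⁻¹

lemma differentiable_inv_Gamma_affine (a b : ℂ) : Differentiable ℂ fun s => (Gamma (a * s + b))⁻¹ :=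
  Complex.differentiable_one_div_Gamma.comp (by fun_prop : Differentiable ℂ fun s : ℂ => a * s + b)

lemma FEData.differentiable_invGamma (F : FEData) : Differentiable ℂ F.invGamma := by
  unfold FEData.invGamma
  exact Differentiable.fun_finsetProd fun j _ => differentiable_inv_Gamma_affine _ _

lemma FEData.differentiable_invGammaDual (F : FEData) : Differentiable ℂ F.invGammaDual := by
  unfold FEData.invGammaDual
  refine Differentiable.fun_finsetProd fun j _ => ?_
  have h (s : ℂ) : (F.lam j : ℂ) * (1 - s) + conj (F.mu j) =
      -(F.lam j : ℂ) * s + (F.lam j + conj (F.mu j)) := by ring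
  simp only [h]
  exact differentiable_inv_Gamma_affine _ _

lemma FEData.invGamma_one_ne_zero (F : FEData) : F.invGamma 1 ≠ 0 := by
  refine Finset.prod_ne_zero_iff.2 fun j _ => inv_ne_zero (Complex.Gamma_ne_zero_of_re_pos ?_)
  have := F.lam_pos j
  have := F.mu_re_nonneg j
  simp
  linarith

lemma FEData.invGammaDual_ne_zero (F : FEData) {s : ℂ} (hs : s.re < 1) : F.invGammaDual s ≠ 0 := by
  refine Finset.prod_ne_zero_iff.2 fun j _ => inv_ne_zero (Complex.Gamma_ne_zero_of_re_pos ?_)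
  have h1 := F.lam_pos j
  have h2 := F.mu_re_nonneg j
  have h3 : 0 < F.lam j * (1 - s.re) := mul_pos h1 (by linarith)
  simp
  linarith

lemma FEData.completed_mul (F : FEData) (L : ℂ → ℂ) {s : ℂ} (h1 : F.invGamma s ≠ 0)
    (h2 : F.invGammaDual s ≠ 0)
    (h : F.completed L s = F.omega * conj (F.completed L (1 - conj s))) :
    L s * (F.Q : ℂ) ^ s * F.invGammaDual s =
      F.omega * conj (L (1 - conj s)) * (F.Q : ℂ) ^ (1 - s) * F.invGamma s := by
  have e1 : ∏ j, Gamma ((F.lam j : ℂ) * s + F.mu j) = (F.invGamma s)⁻¹ := by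
    simp [FEData.invGamma]
  have e2 : conj (∏ j, Gamma ((F.lam j : ℂ) * (1 - conj s) + F.mu j)) = (F.invGammaDual s)⁻¹ := by
    rw [FEData.invGammaDual, map_prod, ← Finset.prod_inv_distrib]
    refine Finset.prod_congr rfl fun j _ => ?_
    rw [← Complex.Gamma_conj, inv_inv]
    simp
  have e3 : conj ((F.Q : ℂ) ^ (1 - conj s)) = (F.Q : ℂ) ^ (1 - s) := by
    have harg : (F.Q : ℂ).arg ≠ Real.pi := by
      rw [Complex.arg_ofReal_of_nonneg F.Q_pos.le]
      exact Real.pi_pos.ne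
    have := Complex.cpow_conj (F.Q : ℂ) (1 - conj s) harg
    rw [Complex.conj_ofReal] at this
    rw [← this]
    simp
  rw [FEData.completed, FEData.completed, e1, map_mul, map_mul, e2, e3] at h
  field_simp at h
  linear_combination h

/-- Away from `0` and `1` the functional equation holds at every point, once the Gamma factors are
moved to the side on which they are entire. -/
lemma SatisfiesFE.eq (hF : SatisfiesFE F L) (hL : IsLFunction L) {s : ℂ} (h0 : s ≠ 0) (h1 : s ≠ 1) :
    L s * (F.Q : ℂ) ^ s * F.invGammaDual s =
      F.omega * conj (L (1 - conj s)) * (F.Q : ℂ) ^ (1 - s) * F.invGamma s := by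
  have hQ : (F.Q : ℂ) ≠ 0 := by exact_mod_cast F.Q_pos.ne'
  have hev : (fun s => L s * (F.Q : ℂ) ^ s * F.invGammaDual s) =ᶠ[codiscrete ℂ] fun s =>
      F.omega * conj (L (1 - conj s)) * (F.Q : ℂ) ^ (1 - s) * F.invGamma s := by
    have a1 := AnalyticOnNhd.preimage_zero_mem_codiscrete
      (Complex.analyticOnNhd_univ_iff_differentiable.2 F.differentiable_invGamma)
      F.invGamma_one_ne_zero
    have a2 := AnalyticOnNhd.preimage_zero_mem_codiscrete
      (Complex.analyticOnNhd_univ_iff_differentiable.2 F.differentiable_invGammaDual)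
      (F.invGammaDual_ne_zero (s := 0) (by simp))
    filter_upwards [hF, a1, a2] with z hz hz1 hz2
    exact F.completed_mul L hz1 hz2 hz
  have c1 := (hL.differentiableAt h1).continuousAt
  have c2 : ContinuousAt (fun s => conj (L (1 - conj s))) s := by
    have h2 : 1 - conj s ≠ 1 := by simpa using h0
    refine Complex.continuous_conj.continuousAt.comp ?_
    refine ContinuousAt.comp (f := fun s => 1 - conj s) (hL.differentiableAt h2).continuousAt ?_
    exact (continuous_const.sub Complex.continuous_conj).continuousAt
  have c3 := F.differentiable_invGamma.continuous.continuousAt (x := s)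
  have c4 := F.differentiable_invGammaDual.continuous.continuousAt (x := s)
  have c5 : ContinuousAt (fun s : ℂ => (F.Q : ℂ) ^ s) s := continuousAt_const_cpow hQ
  have c6 : ContinuousAt (fun s : ℂ => (F.Q : ℂ) ^ (1 - s)) s := by
    refine ContinuousAt.comp (f := fun s => 1 - s) (continuousAt_const_cpow hQ) ?_
    fun_prop
  exact eq_of_eventuallyEq_codiscrete hev ((c1.mul c5).mul c4)
    (((continuousAt_const.mul c2).mul c6).mul c3)

end MovingTarget

/-! ### Entire functions of finite order in a vertical strip -/

namespace MovingTarget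

open Asymptotics Topology Complex

lemma eventually_cobounded_of_eventually_atTop {p : ℝ → Prop} (h : ∀ᶠ r in atTop, p r) :
    ∀ᶠ s : ℂ in Bornology.cobounded ℂ, p ‖s‖ :=
  tendsto_norm_cobounded_atTop.eventually h

lemma IsEntireOfFiniteOrder.mul_exp_sq {G : ℂ → ℂ} (hG : IsEntireOfFiniteOrder G) (c : ℂ) :
    IsEntireOfFiniteOrder fun s => G s * exp ((s - c) ^ 2) := by
  obtain ⟨hd, A, hA⟩ := hG
  set B := max A 2 with hB
  refine ⟨by fun_prop, B + 1, ?_⟩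
  obtain ⟨K, hK⟩ := hA.bound
  refine IsBigO.of_bound K ?_
  have hev := eventually_cobounded_of_eventually_atTop
    (eventually_ge_atTop (max 5 ‖c‖))
  filter_upwards [hK, hev] with s h1 h2
  have h5 : 5 ≤ ‖s‖ := (le_max_left _ _).trans h2
  have hc : ‖c‖ ≤ ‖s‖ := (le_max_right _ _).trans h2
  have e1 : ‖s‖ ^ A ≤ ‖s‖ ^ B := Real.rpow_le_rpow_of_exponent_le (by linarith) (le_max_left _ _)
  have e2 : ‖s‖ ^ 2 ≤ ‖s‖ ^ B := by
    rw [← Real.rpow_natCast]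
    exact Real.rpow_le_rpow_of_exponent_le (by linarith) (by simp [hB])
  have e3 : ‖exp ((s - c) ^ 2)‖ ≤ Real.exp (4 * ‖s‖ ^ B) := by
    rw [Complex.norm_exp]
    refine Real.exp_le_exp.2 ((Complex.re_le_norm _).trans ?_)
    rw [norm_pow]
    have : ‖s - c‖ ≤ 2 * ‖s‖ := (norm_sub_le _ _).trans (by linarith)
    calc ‖s - c‖ ^ 2 ≤ (2 * ‖s‖) ^ 2 := by gcongr
      _ = 4 * ‖s‖ ^ 2 := by ring
      _ ≤ _ := by gcongr
  have e4 : ‖s‖ ^ (B + 1) = ‖s‖ ^ B * ‖s‖ := by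
    rw [Real.rpow_add (by linarith), Real.rpow_one]
  have hBpos : 0 ≤ ‖s‖ ^ B := by positivity
  rw [Real.norm_of_nonneg (Real.exp_pos _).le] at h1 ⊢
  have hK0 : 0 ≤ K := nonneg_of_mul_nonneg_left ((norm_nonneg _).trans h1) (Real.exp_pos _)
  rw [norm_mul]
  calc ‖G s‖ * ‖exp ((s - c) ^ 2)‖
      ≤ (K * Real.exp (‖s‖ ^ A)) * Real.exp (4 * ‖s‖ ^ B) := by gcongr
    _ = K * Real.exp (‖s‖ ^ A + 4 * ‖s‖ ^ B) := by rw [mul_assoc, ← Real.exp_add]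
    _ ≤ _ := by
      gcongr
      rw [e4]
      nlinarith

/-- The Phragmén-Lindelöf principle for entire functions of finite order in `-1 ≤ re s ≤ 2`. -/
lemma IsEntireOfFiniteOrder.norm_le_of_strip {G : ℂ → ℂ} (hG : IsEntireOfFiniteOrder G) {C : ℝ}
    (h1 : ∀ s : ℂ, s.re = -1 → ‖G s‖ ≤ C) (h2 : ∀ s : ℂ, s.re = 2 → ‖G s‖ ≤ C) {s : ℂ}
    (hs1 : -1 ≤ s.re) (hs2 : s.re ≤ 2) : ‖G s‖ ≤ C := by
  obtain ⟨hd, A, hA⟩ := hG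
  refine PhragmenLindelof.vertical_strip hd.diffContOnCl ?_ h1 h2 hs1 hs2
  refine ⟨1, ?_, 1, ?_⟩
  · rw [lt_div_iff₀ (by norm_num)]
    linarith [Real.pi_gt_three]
  set l := comap (_root_.abs ∘ im) atTop ⊓ 𝓟 (re ⁻¹' Set.Ioo (-1 : ℝ) 2) with hl
  have hrpow : ∀ᶠ r : ℝ in atTop, (2 * r) ^ max A 0 ≤ Real.exp r := by
    have := (isLittleO_rpow_exp_pos_mul_atTop (max A 0) (b := 1 / 2) (by norm_num)).bound one_pos
    filter_upwards [(tendsto_id.const_mul_atTop (two_pos (α := ℝ))).eventually this,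
      eventually_ge_atTop 0] with r hr h0
    simp only [id, one_mul] at hr
    rw [Real.norm_of_nonneg (by positivity), Real.norm_of_nonneg (Real.exp_pos _).le] at hr
    convert hr using 2
    ring
  have him : Tendsto (fun s : ℂ => |s.im|) l atTop := tendsto_comap.mono_left inf_le_left
  have hstrip : ∀ᶠ s : ℂ in l, s.re ∈ Set.Ioo (-1 : ℝ) 2 :=
    (eventually_principal.2 fun s hs => hs).filter_mono inf_le_right
  -- `l` is the filter of the Phragmén-Lindelöf theorem, on which `‖s‖` and `|im s|` are comparable
  have hcob : l ≤ Bornology.cobounded ℂ := by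
    rw [← tendsto_id', ← tendsto_norm_atTop_iff_cobounded]
    exact tendsto_atTop_mono (fun s => Complex.abs_im_le_norm s) him
  refine (hA.mono hcob).trans (IsBigO.of_bound 1 ?_)
  filter_upwards [him.eventually hrpow, hstrip, him.eventually (eventually_ge_atTop 2)]
    with s h3 h4 h5
  rw [Real.norm_of_nonneg (Real.exp_pos _).le, Real.norm_of_nonneg (Real.exp_pos _).le, one_mul,
    one_mul, one_mul]
  refine Real.exp_le_exp.2 (le_trans ?_ h3)
  have h6 : ‖s‖ ≤ 2 * |s.im| := by
    refine (Complex.norm_le_abs_re_add_abs_im s).trans ?_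
    have : |s.re| ≤ 2 := abs_le.2 ⟨by linarith [h4.1], h4.2.le⟩
    linarith
  have h7 : 1 ≤ ‖s‖ := by
    have := Complex.abs_im_le_norm s
    linarith
  calc ‖s‖ ^ A ≤ ‖s‖ ^ max A 0 := Real.rpow_le_rpow_of_exponent_le h7 (le_max_left _ _)
    _ ≤ _ := Real.rpow_le_rpow (norm_nonneg _) h6 (le_max_right _ _)

/-- `|f s| ≤ exp (C (1 + |s|) ^ p)` on `S`, for some `C`. The shift `1 + |s|` makes the bound hold
uniformly near `0`. -/
def ExpBoundedOn (p : ℝ) (S : Set ℂ) (f : ℂ → ℂ) : Prop :=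
  ∃ C : ℝ, 0 ≤ C ∧ ∀ s ∈ S, ‖f s‖ ≤ Real.exp (C * (1 + ‖s‖) ^ p)

lemma ExpBoundedOn.mul {p : ℝ} {S : Set ℂ} {f g : ℂ → ℂ} (hf : ExpBoundedOn p S f)
    (hg : ExpBoundedOn p S g) : ExpBoundedOn p S fun s => f s * g s := by
  obtain ⟨C, hC0, hC⟩ := hf
  obtain ⟨D, hD0, hD⟩ := hg
  refine ⟨C + D, by positivity, fun s hs => ?_⟩
  rw [norm_mul, add_mul, Real.exp_add]
  exact mul_le_mul (hC s hs) (hD s hs) (norm_nonneg _) (Real.exp_pos _).le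

lemma expBoundedOn_of_norm_le {p : ℝ} (hp : 0 ≤ p) {S : Set ℂ} {f : ℂ → ℂ} {C : ℝ}
    (h : ∀ s ∈ S, ‖f s‖ ≤ C) : ExpBoundedOn p S f := by
  refine ⟨|C|, abs_nonneg C, fun s hs => (h s hs).trans ?_⟩
  have h1 : (1 : ℝ) ≤ (1 + ‖s‖) ^ p := Real.one_le_rpow (by linarith [norm_nonneg s]) hp
  have h2 := Real.add_one_le_exp (|C| * (1 + ‖s‖) ^ p)
  have h3 := le_abs_self C
  nlinarith [abs_nonneg C]

lemma expBoundedOn_prod {p : ℝ} (hp : 0 ≤ p) {S : Set ℂ} {ι : Type*} (t : Finset ι)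
    (f : ι → ℂ → ℂ) (h : ∀ i ∈ t, ExpBoundedOn p S (f i)) :
    ExpBoundedOn p S fun s => ∏ i ∈ t, f i s := by
  classical
  induction t using Finset.induction_on with
  | empty => exact expBoundedOn_of_norm_le hp (C := 1) (by simp)
  | insert a t ha ih =>
    simp only [Finset.prod_insert ha]
    exact (h a (Finset.mem_insert_self a t)).mul (ih fun i hi => h i (Finset.mem_insert_of_mem hi))

lemma expBoundedOn_comp_affine {p : ℝ} (hp : 0 ≤ p) {S : Set ℂ} {f : ℂ → ℂ} {C : ℝ} (a b : ℂ)
    (h : ∀ s ∈ S, ‖f s‖ ≤ Real.exp (C * (1 + ‖a * s + b‖) ^ p)) : ExpBoundedOn p S f := by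
  refine ⟨|C| * (1 + ‖a‖ + ‖b‖) ^ p, by positivity, fun s hs => (h s hs).trans ?_⟩
  refine Real.exp_le_exp.2 ?_
  have h1 : 1 + ‖a * s + b‖ ≤ (1 + ‖a‖ + ‖b‖) * (1 + ‖s‖) := by
    have := norm_add_le (a * s) b
    rw [norm_mul] at this
    nlinarith [norm_nonneg a, norm_nonneg b, norm_nonneg s,
      mul_nonneg (norm_nonneg b) (norm_nonneg s)]
  rw [mul_assoc, ← Real.mul_rpow (by positivity) (by positivity)]
  calc _ ≤ |C| * (1 + ‖a * s + b‖) ^ p := by gcongr; exact le_abs_self C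
    _ ≤ _ := by gcongr

/-- A bound of order less than two outside a vertical strip extends to the whole plane: near the
height `t₀`, the factor `exp((s - i t₀)²)` localizes the boundary values. -/
lemma IsEntireOfFiniteOrder.expBoundedOn_univ {G : ℂ → ℂ} (hG : IsEntireOfFiniteOrder G) {p : ℝ}
    (hp0 : 1 ≤ p) (hp2 : p < 2) (h1 : ExpBoundedOn p {s | s.re ≤ -1} G)
    (h2 : ExpBoundedOn p {s | 2 ≤ s.re} G) : ExpBoundedOn p Set.univ G := by
  obtain ⟨C1, hC10, hC1⟩ := h1
  obtain ⟨C2, hC20, hC2⟩ := h2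
  set C := max C1 C2 with hC
  have hC0 : 0 ≤ C := hC10.trans (le_max_left _ _)
  obtain ⟨D, hD0, hD⟩ : ∃ D : ℝ, 0 ≤ D ∧ ∀ u : ℝ, 0 ≤ u → C * 2 ^ p * u ^ p ≤ u ^ 2 + D := by
    have hlo := ((isLittleO_rpow_atTop_of_lt hp2).const_mul_left (C * 2 ^ p)).bound one_pos
    obtain ⟨U, hU⟩ := eventually_atTop.1 (hlo.and (eventually_ge_atTop 0))
    refine ⟨C * 2 ^ p * (max U 0) ^ p, by positivity, fun u hu => ?_⟩
    rcases le_or_gt U u with h | h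
    · have h3 := (hU u h).1
      rw [one_mul, Real.norm_of_nonneg (by positivity), Real.norm_of_nonneg (by positivity),
        Real.rpow_two] at h3
      have : 0 ≤ C * 2 ^ p * (max U 0) ^ p := by positivity
      linarith
    · have h3 : u ^ p ≤ (max U 0) ^ p :=
        Real.rpow_le_rpow hu (h.le.trans (le_max_left _ _)) (by linarith)
      have : C * 2 ^ p * u ^ p ≤ C * 2 ^ p * (max U 0) ^ p := by gcongr
      nlinarith
  refine ⟨C * 2 ^ p * 3 ^ p + D + 4 + C, by positivity, fun s _ => ?_⟩
  have hone : (1 : ℝ) ≤ (1 + ‖s‖) ^ p :=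
    Real.one_le_rpow (by linarith [norm_nonneg s]) (by linarith)
  have hnn : 0 ≤ C * 2 ^ p * 3 ^ p := by positivity
  have hmax : ∀ C' : ℝ, C' ≤ C → C' * (1 + ‖s‖) ^ p ≤
      (C * 2 ^ p * 3 ^ p + D + 4 + C) * (1 + ‖s‖) ^ p := by
    intro C' h
    gcongr
    linarith
  rcases le_total s.re (-1) with hs | hs
  · exact (hC1 s hs).trans (Real.exp_le_exp.2 (hmax C1 (le_max_left _ _)))
  rcases le_total 2 s.re with hs' | hs'
  · exact (hC2 s hs').trans (Real.exp_le_exp.2 (hmax C2 (le_max_right _ _)))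
  set t := s.im with ht
  set B := C * 2 ^ p * (3 + |t|) ^ p + D + 4 with hB
  have hedge : ∀ w : ℂ, w.re ^ 2 ≤ 4 → |w.re| ≤ 2 → ‖G w‖ ≤ Real.exp (C * (1 + ‖w‖) ^ p) →
      ‖G w * exp ((w - t * I) ^ 2)‖ ≤ Real.exp B := by
    intro w hw1 hw2 hw3
    rw [norm_mul, Complex.norm_exp]
    have e1 : ((w - t * I) ^ 2).re = w.re ^ 2 - |w.im - t| ^ 2 := by
      rw [sq_abs]
      simp [sq]
    rw [e1]
    refine (mul_le_mul_of_nonneg_right hw3 (Real.exp_pos _).le).trans ?_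
    rw [← Real.exp_add]
    refine Real.exp_le_exp.2 ?_
    set u := |w.im - t| with hu
    have hu0 : 0 ≤ u := abs_nonneg _
    have e2 : 1 + ‖w‖ ≤ (3 + |t|) + u := by
      have h3 := Complex.norm_le_abs_re_add_abs_im w
      have h4 : |w.im| ≤ |t| + u := by
        have := abs_add_le t (w.im - t)
        rwa [add_sub_cancel] at this
      linarith
    have ht0 : 0 ≤ |t| := abs_nonneg t
    have e3 : (1 + ‖w‖) ^ p ≤ 2 ^ p * (3 + |t|) ^ p + 2 ^ p * u ^ p := by
      have hp0' : 0 ≤ p := by linarith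
      rcases le_total u (3 + |t|) with h | h
      · calc (1 + ‖w‖) ^ p ≤ (2 * (3 + |t|)) ^ p := by gcongr; linarith
          _ = 2 ^ p * (3 + |t|) ^ p := Real.mul_rpow (by norm_num) (by positivity)
          _ ≤ _ := le_add_of_nonneg_right (by positivity)
      · calc (1 + ‖w‖) ^ p ≤ (2 * u) ^ p := by gcongr; linarith
          _ = 2 ^ p * u ^ p := Real.mul_rpow (by norm_num) (by positivity)
          _ ≤ _ := le_add_of_nonneg_left (by positivity)
    have e4 := hD u hu0
    have e5 := mul_le_mul_of_nonneg_left e3 hC0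
    rw [hB]
    nlinarith
  have hmain := (hG.mul_exp_sq (t * I)).norm_le_of_strip (C := Real.exp B)
    (fun w hw => hedge w (by rw [hw]; norm_num) (by rw [hw]; norm_num) ((hC1 w hw.le).trans
      (Real.exp_le_exp.2 (by gcongr; exact le_max_left _ _))))
    (fun w hw => hedge w (by rw [hw]; norm_num) (by rw [hw]; norm_num) ((hC2 w hw.ge).trans
      (Real.exp_le_exp.2 (by gcongr; exact le_max_right _ _)))) hs hs'
  rw [norm_mul, Complex.norm_exp] at hmain
  have e1 : ((s - t * I) ^ 2).re = s.re ^ 2 := by simp [sq, ht]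
  rw [e1] at hmain
  have e2 : ‖G s‖ ≤ Real.exp B :=
    (le_mul_of_one_le_right (norm_nonneg _) (Real.one_le_exp (sq_nonneg _))).trans hmain
  refine e2.trans (Real.exp_le_exp.2 ?_)
  have e3 : (3 + |t|) ^ p ≤ 3 ^ p * (1 + ‖s‖) ^ p := by
    have := norm_nonneg s
    rw [← Real.mul_rpow (by norm_num) (by positivity)]
    have := Complex.abs_im_le_norm s
    have hp0' : 0 ≤ p := by linarith
    gcongr
    linarith
  have e4 := mul_le_mul_of_nonneg_left e3 (by positivity : 0 ≤ C * 2 ^ p)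
  rw [hB]
  nlinarith

/-! ### L-functions have order at most one -/

lemma norm_ofReal_cpow {Q : ℝ} (hQ : 0 < Q) (s : ℂ) :
    ‖(Q : ℂ) ^ s‖ = Real.exp (Real.log Q * s.re) := by
  rw [Complex.norm_cpow_eq_rpow_re_of_pos hQ, Real.rpow_def_of_pos hQ]

lemma expBoundedOn_cpow {Q : ℝ} (hQ : 0 < Q) {p : ℝ} (hp : 1 ≤ p) (S : Set ℂ) (a b : ℂ) :
    ExpBoundedOn p S fun s => (Q : ℂ) ^ (a * s + b) := by
  refine expBoundedOn_comp_affine (by linarith) (C := |Real.log Q|) a b fun s _ => ?_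
  rw [norm_ofReal_cpow hQ]
  refine Real.exp_le_exp.2 ((le_abs_self _).trans ?_)
  rw [abs_mul]
  have h1 := Complex.abs_re_le_norm (a * s + b)
  have h2 : 1 + ‖a * s + b‖ ≤ (1 + ‖a * s + b‖) ^ p :=
    Real.self_le_rpow_of_one_le (by linarith [norm_nonneg (a * s + b)]) hp
  gcongr
  linarith

lemma expBoundedOn_sub_one_pow {p : ℝ} (hp : 1 ≤ p) (S : Set ℂ) (k : ℕ) :
    ExpBoundedOn p S fun s => (s - 1) ^ k := by
  have h1 : ExpBoundedOn p S fun s => s - 1 := by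
    refine ⟨1, zero_le_one, fun s _ => ?_⟩
    have h1 := norm_sub_le s 1
    rw [norm_one] at h1
    have h2 : 1 + ‖s‖ ≤ (1 + ‖s‖) ^ p :=
      Real.self_le_rpow_of_one_le (by linarith [norm_nonneg s]) hp
    have h3 := Real.add_one_le_exp (1 * (1 + ‖s‖) ^ p)
    linarith
  have := expBoundedOn_prod (by linarith : 0 ≤ p) (Finset.range k) (fun _ s => s - 1) fun _ _ => h1
  simpa using this

/-- The functional equation bounds an L-function in the left half-plane. -/
lemma expBoundedOn_of_satisfiesFE {L : ℂ → ℂ} {F : FEData} (hL : IsLFunction L)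
    (hF : SatisfiesFE F L) {p : ℝ} (hp : 1 < p) : ExpBoundedOn p {s | s.re ≤ -1} L := by
  have hp0 : 0 ≤ p := by linarith
  obtain ⟨C, hC0, hC⟩ := hL.exists_norm_le
  have hQ : (F.Q : ℂ) ≠ 0 := by exact_mod_cast F.Q_pos.ne'
  have b1 : ExpBoundedOn p {s | s.re ≤ -1} fun s => F.omega * conj (L (1 - conj s)) := by
    refine expBoundedOn_of_norm_le hp0 (C := C) fun s hs => ?_
    rw [norm_mul, F.norm_omega, one_mul, Complex.norm_conj]
    refine hC _ ?_
    have hs' : s.re ≤ -1 := hs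
    simp
    linarith
  have b2 : ExpBoundedOn p {s | s.re ≤ -1} F.invGamma := by
    refine expBoundedOn_prod hp0 _ _ fun j _ => ?_
    obtain ⟨D, hD⟩ := exists_norm_inv_Gamma_le_exp (sub_pos.2 hp)
    refine expBoundedOn_comp_affine hp0 (C := D) (F.lam j) (F.mu j) fun s _ => ?_
    simpa using hD (F.lam j * s + F.mu j)
  have b3 : ExpBoundedOn p {s | s.re ≤ -1} fun s => (F.invGammaDual s)⁻¹ := by
    have : (fun s => (F.invGammaDual s)⁻¹) =
        fun s => ∏ j, Gamma ((F.lam j : ℂ) * (1 - s) + conj (F.mu j)) := by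
      funext s
      simp [FEData.invGammaDual]
    rw [this]
    refine expBoundedOn_prod hp0 _ _ fun j _ => ?_
    have hl := F.lam_pos j
    have hm := F.mu_re_nonneg j
    obtain ⟨D, hD⟩ := exists_norm_Gamma_le_exp hl (sub_pos.2 hp)
    refine expBoundedOn_comp_affine hp0 (C := D) (-F.lam j) (F.lam j + conj (F.mu j)) fun s hs => ?_
    have e : (F.lam j : ℂ) * (1 - s) + conj (F.mu j) =
      -(F.lam j : ℂ) * s + (F.lam j + conj (F.mu j)) := by ring
    rw [← e]
    have hre : F.lam j ≤ ((F.lam j : ℂ) * (1 - s) + conj (F.mu j)).re := by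
      have hs' : s.re ≤ -1 := hs
      simp
      nlinarith
    simpa using hD _ hre
  have b4 := expBoundedOn_cpow F.Q_pos hp.le {s | s.re ≤ -1} (-2) 1
  obtain ⟨D, hD0, hD⟩ := ((b1.mul b4).mul b2).mul b3
  refine ⟨D, hD0, fun s hs => ?_⟩
  refine le_trans (le_of_eq ?_) (hD s hs)
  congr 1
  have hs' : s.re ≤ -1 := hs
  have h0 : s ≠ 0 := by rintro rfl; norm_num at hs'
  have h1 : s ≠ 1 := by rintro rfl; norm_num at hs'
  have hfe := hF.eq hL h0 h1
  have hne := F.invGammaDual_ne_zero (s := s) (by linarith)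
  have hQs : (F.Q : ℂ) ^ s ≠ 0 := by simp [Complex.cpow_eq_zero_iff, hQ]
  have e : (F.Q : ℂ) ^ (-2 * s + 1) * (F.Q : ℂ) ^ s = (F.Q : ℂ) ^ (1 - s) := by
    rw [← Complex.cpow_add _ _ hQ]
    congr 1
    ring
  beta_reduce
  rw [← div_eq_mul_inv, eq_div_iff hne]
  refine mul_right_cancel₀ hQs ?_
  calc _ = L s * (F.Q : ℂ) ^ s * F.invGammaDual s := by ring
    _ = _ := by rw [hfe, ← e]; ring

/-- An L-function has order at most one: it is bounded in the right half-plane, the functional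
equation controls it in the left one, and the strip between is covered by the Phragmén-Lindelöf
principle. -/
lemma IsLFunction.hasOrderLE {L : ℂ → ℂ} (hL : IsLFunction L) : HasOrderLE L 1 := by
  obtain ⟨F, hF⟩ := hL.functional_equation
  obtain ⟨k, G, hG, h⟩ := hL.continuation
  have hL' : ∀ s, s ≠ 1 → L s = G s / (s - 1) ^ k := fun s hs => by
    rw [← h s hs, mul_div_cancel_left₀ _ (pow_ne_zero _ (sub_ne_zero.2 hs))]
  have key : ∀ p : ℝ, 1 < p → p < 2 → ExpBoundedOn p Set.univ G := by
    intro p hp1 hp2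
    obtain ⟨C, hC0, hC⟩ := hL.exists_norm_le
    have b1 := (expBoundedOn_sub_one_pow hp1.le {s : ℂ | s.re ≤ -1} k).mul
      (expBoundedOn_of_satisfiesFE hL hF hp1)
    have b2 := (expBoundedOn_sub_one_pow hp1.le {s : ℂ | 2 ≤ s.re} k).mul
      (expBoundedOn_of_norm_le (p := p) (by linarith) (S := {s : ℂ | 2 ≤ s.re}) hC)
    refine hG.expBoundedOn_univ hp1.le hp2 ?_ ?_
    · obtain ⟨D, hD0, hD⟩ := b1
      refine ⟨D, hD0, fun s hs => ?_⟩
      have hs' : s.re ≤ -1 := hs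
      rw [← h s (by rintro rfl; norm_num at hs')]
      exact hD s hs
    · obtain ⟨D, hD0, hD⟩ := b2
      refine ⟨D, hD0, fun s hs => ?_⟩
      have hs' : 2 ≤ s.re := hs
      rw [← h s (by rintro rfl; norm_num at hs')]
      exact hD s hs
  have hGo : HasOrderLE G 1 := by
    refine hasOrderLE_of_norm_le hG.1 fun ε hε => ?_
    set δ := min ε (1 / 2) with hδ
    have hδ0 : 0 < δ := lt_min hε (by norm_num)
    have hδ1 : δ ≤ 1 / 2 := min_le_right _ _
    obtain ⟨D, hD0, hD⟩ := key (1 + δ) (by linarith) (by linarith)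
    refine ⟨D * 2 ^ (1 + δ), 1, fun z hz => (hD z (Set.mem_univ z)).trans (Real.exp_le_exp.2 ?_)⟩
    have e1 : (1 + ‖z‖) ^ (1 + δ) ≤ 2 ^ (1 + δ) * ‖z‖ ^ (1 + δ) := by
      rw [← Real.mul_rpow (by norm_num) (by positivity)]
      gcongr
      linarith
    have e2 : ‖z‖ ^ (1 + δ) ≤ ‖z‖ ^ (1 + ε) :=
      Real.rpow_le_rpow_of_exponent_le hz (by linarith [min_le_left ε (1 / 2)])
    rw [mul_assoc]
    gcongr
    refine e1.trans ?_
    gcongr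
  have hpow : HasOrderLE (fun s => (s - 1) ^ k) 0 := by
    simpa using hasOrderLE_sub_one_zpow k
  refine HasOrderLE.congr (HasOrderLE.div (meromorphic_of_differentiable hG.1)
    (meromorphic_of_differentiable (by fun_prop)) zero_le_one hGo (hpow.mono zero_le_one)) ?_
  filter_upwards [compl_singleton_mem_codiscrete 1] with s hs
  exact (hL' s hs).symm

end MovingTarget

/-! ### The functional equation without growth -/

namespace MovingTarget

open Asymptotics Topology Complex

lemma FEData.invGamma_of_K_eq_zero {F : FEData} (hK : F.K = 0) (s : ℂ) : F.invGamma s = 1 := by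
  have : IsEmpty (Fin F.K) := by rw [hK]; infer_instance
  simp [FEData.invGamma]

lemma FEData.invGammaDual_of_K_eq_zero {F : FEData} (hK : F.K = 0) (s : ℂ) :
    F.invGammaDual s = 1 := by
  have : IsEmpty (Fin F.K) := by rw [hK]; infer_instance
  simp [FEData.invGammaDual]

/-- Without Gamma factors and with `Q ≤ 1` the only L-function is the constant `1`: it is bounded
in the left half-plane by the functional equation, and hence everywhere. -/
lemma IsLFunction.eq_one_of_K_eq_zero {L : ℂ → ℂ} {F : FEData} (hL : IsLFunction L)
    (hF : SatisfiesFE F L) (hK : F.K = 0) (hQ1 : F.Q ≤ 1) {s : ℂ} (hs : s ≠ 1) : L s = 1 := by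
  have hQ : (F.Q : ℂ) ≠ 0 := by exact_mod_cast F.Q_pos.ne'
  have hfe : ∀ s : ℂ, s ≠ 0 → s ≠ 1 →
      L s = F.omega * conj (L (1 - conj s)) * (F.Q : ℂ) ^ (1 - 2 * s) := by
    intro s h0 h1
    have h := hF.eq hL h0 h1
    rw [FEData.invGamma_of_K_eq_zero hK, FEData.invGammaDual_of_K_eq_zero hK, mul_one, mul_one] at h
    have hQs : (F.Q : ℂ) ^ s ≠ 0 := by simp [Complex.cpow_eq_zero_iff, hQ]
    have e : (F.Q : ℂ) ^ (1 - 2 * s) * (F.Q : ℂ) ^ s = (F.Q : ℂ) ^ (1 - s) := by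
      rw [← Complex.cpow_add _ _ hQ]
      congr 1
      ring
    refine mul_right_cancel₀ hQs ?_
    rw [h, ← e]
    ring
  set E := Function.update L 1 (limUnder (𝓝[≠] 1) L) with hE
  have hEL : ∀ s, s ≠ 1 → E s = L s := fun s hs => Function.update_of_ne hs _ _
  -- `1` is not a pole, since `0` is not one
  have hE1 : DifferentiableAt ℂ E 1 := by
    have hmem : Metric.closedBall (1 : ℂ) (1 / 2) ∈ 𝓝 (1 : ℂ) :=
      Metric.closedBall_mem_nhds _ (by norm_num)
    refine (Complex.differentiableOn_update_limUnder_of_bddAbove hmem (fun z hz =>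
      (hL.differentiableAt hz.2).differentiableWithinAt) ?_).differentiableAt hmem
    have hc : ContinuousOn (fun s => ‖F.omega * conj (L (1 - conj s)) * (F.Q : ℂ) ^ (1 - 2 * s)‖)
        (Metric.closedBall (1 : ℂ) (1 / 2)) := by
      intro s hs
      refine ContinuousAt.continuousWithinAt (ContinuousAt.norm ?_)
      have h2 : 1 - conj s ≠ 1 := by
        intro h
        have : s = 0 := by simpa using h
        rw [this, Metric.mem_closedBall, dist_zero_left, norm_one] at hs
        norm_num at hs
      have c1 : ContinuousAt (fun s => conj (L (1 - conj s))) s := by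
        refine Complex.continuous_conj.continuousAt.comp ?_
        refine ContinuousAt.comp (f := fun s => 1 - conj s) (hL.differentiableAt h2).continuousAt ?_
        exact (continuous_const.sub Complex.continuous_conj).continuousAt
      have c2 : ContinuousAt (fun s : ℂ => (F.Q : ℂ) ^ (1 - 2 * s)) s := by
        refine ContinuousAt.comp (f := fun s => 1 - 2 * s) (continuousAt_const_cpow hQ) ?_
        fun_prop
      exact (continuousAt_const.mul c1).mul c2
    obtain ⟨B, hB⟩ := (isCompact_closedBall (1 : ℂ) (1 / 2)).bddAbove_image hc
    refine ⟨B, ?_⟩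
    rintro _ ⟨z, hz, rfl⟩
    have h0 : z ≠ 0 := by
      rintro rfl
      have := hz.1
      rw [Metric.mem_closedBall, dist_zero_left, norm_one] at this
      norm_num at this
    simp only [Function.comp_apply]
    rw [hfe z h0 hz.2]
    exact hB ⟨z, hz.1, rfl⟩
  have hEd : Differentiable ℂ E := by
    intro z
    rcases eq_or_ne z 1 with rfl | hz
    · exact hE1
    · refine (hL.differentiableAt hz).congr_of_eventuallyEq ?_
      filter_upwards [continuousAt_id.eventually_ne hz] with w hw
      exact hEL w hw
  obtain ⟨k, G, ⟨-, A, hA⟩, hG⟩ := hL.continuation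
  have hfin : IsEntireOfFiniteOrder E := by
    refine ⟨hEd, A, (IsBigO.of_bound 1 ?_).trans hA⟩
    filter_upwards [eventually_cobounded_of_eventually_atTop (eventually_ge_atTop 2)] with z hz
    have h1 : z ≠ 1 := by rintro rfl; norm_num at hz
    rw [hEL z h1, ← hG z h1, norm_mul, norm_pow, one_mul]
    refine le_mul_of_one_le_left (norm_nonneg _) (one_le_pow₀ ?_)
    have := norm_sub_norm_le z 1
    rw [norm_one] at this
    linarith
  obtain ⟨C, hC0, hC⟩ := hL.exists_norm_le
  have hright : ∀ z : ℂ, 2 ≤ z.re → ‖E z‖ ≤ C := by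
    intro z hz
    rw [hEL z (by rintro rfl; norm_num at hz)]
    exact hC z hz
  have hleft : ∀ z : ℂ, z.re ≤ -1 → ‖E z‖ ≤ C := by
    intro z hz
    have h1 : z ≠ 1 := by rintro rfl; norm_num at hz
    rw [hEL z h1, hfe z (by rintro rfl; norm_num at hz) h1, norm_mul, norm_mul, F.norm_omega,
      one_mul, Complex.norm_conj, norm_ofReal_cpow F.Q_pos]
    have h2 : ‖L (1 - conj z)‖ ≤ C := hC _ (by simp; linarith)
    have h3 : Real.exp (Real.log F.Q * (1 - 2 * z).re) ≤ 1 := by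
      rw [Real.exp_le_one_iff]
      refine mul_nonpos_of_nonpos_of_nonneg (Real.log_nonpos F.Q_pos.le hQ1) ?_
      simp
      linarith
    exact (mul_le_of_le_one_right (norm_nonneg _) h3).trans h2
  have hbound : ∀ z, ‖E z‖ ≤ C := by
    intro z
    rcases le_total z.re (-1) with h | h
    · exact hleft z h
    rcases le_total 2 z.re with h' | h'
    · exact hright z h'
    · exact hfin.norm_le_of_strip (fun w hw => hleft w hw.le) (fun w hw => hright w hw.ge) h h'
  have hbdd : Bornology.IsBounded (Set.range E) := by
    rw [isBounded_iff_forall_norm_le]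
    exact ⟨C, by rintro _ ⟨z, rfl⟩; exact hbound z⟩
  rw [← hEL s hs, ← sub_eq_zero, ← norm_le_zero_iff]
  refine le_of_forall_pos_le_add fun η hη => ?_
  obtain ⟨σ, hσ⟩ := hL.exists_norm_sub_one_le_of_pos hη
  have h1 := hσ ((max σ 2 : ℝ) : ℂ) (by simp)
  have hne : ((max σ 2 : ℝ) : ℂ) ≠ 1 := by
    intro h
    have h2 : max σ 2 = 1 := by exact_mod_cast h
    linarith [le_max_right σ 2]
  rw [hEd.apply_eq_apply_of_bounded hbdd s ((max σ 2 : ℝ) : ℂ), hEL _ hne, zero_add]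
  exact h1

/-! ### Growth of the functional equation in the left half-plane -/

/-- In a closed sector inside the left half-plane and off the real axis, the ratio of `L s` and
`conj (L (1 - conj s))` grows at least exponentially. -/
lemma FEData.exists_exp_mul_le (F : FEData) (hF : F.K ≠ 0 ∨ 1 < F.Q) {κ : ℝ} (hκ : 0 < κ) :
    ∃ c > 0, ∃ R : ℝ, ∀ r ≥ R, ∀ v : ℂ, ‖v‖ = 1 → κ ≤ v.im → v.im + κ ≤ -v.re →
      Real.exp (c * r) * ‖(F.Q : ℂ) ^ ((r : ℂ) * v) * F.invGammaDual (r * v)‖ ≤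
        ‖(F.Q : ℂ) ^ (1 - (r : ℂ) * v) * F.invGamma (r * v)‖ := by
  -- each Gamma factor contributes a factor `exp (b r)`, for every `b ≥ 0`
  have hfactor : ∀ b : ℝ, 0 ≤ b → ∀ j, ∃ R : ℝ, ∀ r ≥ R, ∀ v : ℂ, ‖v‖ = 1 → κ ≤ v.im →
      v.im + κ ≤ -v.re →
      Real.exp (b * r) * ‖(Gamma ((F.lam j : ℂ) * (1 - r * v) + conj (F.mu j)))⁻¹‖ ≤
        ‖(Gamma ((F.lam j : ℂ) * (r * v) + F.mu j))⁻¹‖ := by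
    intro b hb j
    have hl := F.lam_pos j
    have hm := F.mu_re_nonneg j
    set l := F.lam j
    set m := F.mu j
    have hlκ : 0 < l * κ := by positivity
    obtain ⟨R1, hR1⟩ := exists_exp_le_norm_Gamma (M := b / (l * κ)) (by positivity)
    have e1 : ∀ᶠ r : ℝ in atTop, max R1 (1 + |m.re| + |m.im|) ≤ l * κ * r :=
      (tendsto_id.const_mul_atTop hlκ).eventually_ge_atTop _
    obtain ⟨R, hR⟩ := eventually_atTop.1 (e1.and (eventually_ge_atTop 0))
    refine ⟨R, fun r hr v hv him hre => ?_⟩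
    obtain ⟨hr1, hr0⟩ := hR r hr
    have hrA := (le_max_left _ _).trans hr1
    have hrB := (le_max_right _ _).trans hr1
    have hmr := abs_nonneg m.re
    have hmi := abs_nonneg m.im
    have hmr' := le_abs_self m.re
    have hmi' := abs_le.1 (le_refl |m.im|)
    have hlr : 0 ≤ l * r := by positivity
    have p1 : l * κ * r ≤ l * r * v.im := by nlinarith
    have p2 : l * r * v.im + l * κ * r ≤ -(l * r * v.re) := by nlinarith
    set w := (l : ℂ) * (1 - r * v) + conj m with hw
    have hwre : w.re = l - l * r * v.re + m.re := by
      simp [hw]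
      ring
    have hwim : w.im = -(l * r * v.im) - m.im := by
      simp [hw]
      ring
    have hsec : |w.im| ≤ w.re := by
      rw [hwre, hwim, abs_le]
      constructor <;> linarith [hmi'.1, hmi'.2]
    have hnorm : l * κ * r ≤ ‖w‖ := by
      refine le_trans ?_ (Complex.re_le_norm w)
      rw [hwre]
      linarith
    have hlow := hR1 w (hrA.trans hnorm) hsec
    have hlow' : Real.exp (b * r) ≤ ‖Gamma w‖ := by
      refine le_trans (Real.exp_le_exp.2 ?_) hlow
      calc b * r = b / (l * κ) * (l * κ * r) := by field_simp
        _ ≤ _ := by gcongr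
    have hup : ‖Gamma ((l : ℂ) * (r * v) + m)‖ ≤ 1 := by
      refine norm_Gamma_le_one ?_ ?_
      · have : ((l : ℂ) * (r * v) + m).re = l * r * v.re + m.re := by
          simp
          ring
        rw [this]
        linarith
      · have : ((l : ℂ) * (r * v) + m).im = l * r * v.im + m.im := by
          simp
          ring
        rw [this]
        refine le_trans ?_ (le_abs_self _)
        linarith [hmi'.1]
    have hpos : 0 < ‖Gamma ((l : ℂ) * (r * v) + m)‖ := by
      rw [norm_pos_iff]
      refine Complex.Gamma_ne_zero fun n hn => ?_
      have := congrArg Complex.im hn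
      simp at this
      nlinarith [hmi'.1]
    rw [norm_inv, norm_inv]
    have hpos' : 0 < ‖Gamma w‖ := (Real.exp_pos _).trans_le hlow'
    calc Real.exp (b * r) * ‖Gamma w‖⁻¹ ≤ ‖Gamma w‖ * ‖Gamma w‖⁻¹ := by gcongr
      _ = 1 := mul_inv_cancel₀ hpos'.ne'
      _ ≤ _ := (one_le_inv₀ hpos).2 hup
  have hprod : ∀ b : ℝ, 0 ≤ b → ∃ R : ℝ, ∀ r ≥ R, ∀ v : ℂ, ‖v‖ = 1 → κ ≤ v.im →
      v.im + κ ≤ -v.re →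
      Real.exp (b * r) ^ F.K * ‖F.invGammaDual (r * v)‖ ≤ ‖F.invGamma (r * v)‖ := by
    intro b hb
    choose R hR using hfactor b hb
    obtain ⟨R0, hR0⟩ := (Set.finite_range R).bddAbove
    refine ⟨R0, fun r hr v h1 h2 h3 => ?_⟩
    have hcard : Real.exp (b * r) ^ F.K = ∏ _j : Fin F.K, Real.exp (b * r) := by simp
    rw [FEData.invGamma, FEData.invGammaDual, norm_prod, norm_prod, hcard,
      ← Finset.prod_mul_distrib]
    refine Finset.prod_le_prod (fun j _ => by positivity) fun j _ => ?_
    exact hR j r ((hR0 ⟨j, rfl⟩).trans hr) v h1 h2 h3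
  have hκ1 : ∀ v : ℂ, ‖v‖ = 1 → -1 ≤ v.re := fun v hv => by
    have := (abs_le.1 (Complex.abs_re_le_norm v)).1
    rwa [hv] at this
  simp only [norm_mul, norm_ofReal_cpow F.Q_pos]
  by_cases hK : F.K = 0
  · have hQ : 1 < F.Q := hF.resolve_left (fun h => h hK)
    have hlog := Real.log_pos hQ
    refine ⟨2 * Real.log F.Q * κ, by positivity, 0, fun r hr v hv him hre => ?_⟩
    rw [FEData.invGamma_of_K_eq_zero hK, FEData.invGammaDual_of_K_eq_zero hK, norm_one, mul_one,
      mul_one, ← Real.exp_add]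
    refine Real.exp_le_exp.2 ?_
    have h1 : ((r : ℂ) * v).re = r * v.re := by simp
    have h2 : (1 - (r : ℂ) * v).re = 1 - r * v.re := by simp
    rw [h1, h2]
    have h3 : r * κ ≤ r * -v.re := mul_le_mul_of_nonneg_left (by linarith) hr
    nlinarith
  · have hK1 : 1 ≤ F.K := Nat.one_le_iff_ne_zero.2 hK
    set B := 2 * |Real.log F.Q| with hB
    have hB0 : 0 ≤ B := by positivity
    obtain ⟨R, hR⟩ := hprod (B + 2) (by linarith)
    refine ⟨1, one_pos, max R (max 1 |Real.log F.Q|), fun r hr v hv him hre => ?_⟩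
    have hrR : R ≤ r := (le_max_left _ _).trans hr
    have hr1 : 1 ≤ r := (le_max_left _ _).trans ((le_max_right _ _).trans hr)
    have hr2 : |Real.log F.Q| ≤ r := (le_max_right _ _).trans ((le_max_right _ _).trans hr)
    have h := hR r hrR v hv him hre
    have h1 : ((r : ℂ) * v).re = r * v.re := by simp
    have h2 : (1 - (r : ℂ) * v).re = 1 - r * v.re := by simp
    rw [h1, h2]
    have hexp : Real.exp ((B + 2) * r) ≤ Real.exp ((B + 2) * r) ^ F.K :=
      le_self_pow₀ (Real.one_le_exp (by positivity)) hK
    have hv1 := hκ1 v hv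
    have habs := abs_le.1 (le_refl |Real.log F.Q|)
    have h0 : 0 ≤ -(r * v.re) := by nlinarith
    have h0' : -(r * v.re) ≤ r := by nlinarith
    have e1 : 1 * r + Real.log F.Q * (r * v.re) ≤
        Real.log F.Q * (1 - r * v.re) + (B + 2) * r := by
      have : -(|Real.log F.Q| * (1 + 2 * r)) ≤ Real.log F.Q * (1 - 2 * (r * v.re)) := by
        have h3 : |Real.log F.Q * (1 - 2 * (r * v.re))| ≤ |Real.log F.Q| * (1 + 2 * r) := by
          rw [abs_mul]
          gcongr
          rw [abs_of_nonneg (by linarith)]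
          linarith
        linarith [(abs_le.1 h3).1]
      rw [hB]
      nlinarith
    calc Real.exp (1 * r) * (Real.exp (Real.log F.Q * (r * v.re)) * ‖F.invGammaDual (r * v)‖)
        = Real.exp (1 * r + Real.log F.Q * (r * v.re)) * ‖F.invGammaDual (r * v)‖ := by
          rw [Real.exp_add]
          ring
      _ ≤ Real.exp (Real.log F.Q * (1 - r * v.re) + (B + 2) * r) * ‖F.invGammaDual (r * v)‖ := by
          gcongr
      _ = Real.exp (Real.log F.Q * (1 - r * v.re)) *
            (Real.exp ((B + 2) * r) * ‖F.invGammaDual (r * v)‖) := by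
          rw [Real.exp_add]
          ring
      _ ≤ Real.exp (Real.log F.Q * (1 - r * v.re)) *
            (Real.exp ((B + 2) * r) ^ F.K * ‖F.invGammaDual (r * v)‖) := by gcongr
      _ ≤ _ := by gcongr

end MovingTarget

/-! ### Lower bounds in a sector of the left half-plane -/

namespace MovingTarget

open Asymptotics Topology Complex ValueDistribution

/-- In a sector of the left half-plane the functional equation compares `f L₂ - L₁` with
`f l₂ - l₁`, where `l₁` and `l₂` are values in the right half-plane and so close to `1`; hence
`f L₂ - L₁` exceeds `f - 1` by an exponential factor, provided that `f` is not too close to `1`. -/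
lemma exists_norm_mul_sub_ge {L₁ L₂ : ℂ → ℂ} {F : FEData} (hL₁ : IsLFunction L₁)
    (hL₂ : IsLFunction L₂) (hF₁ : SatisfiesFE F L₁) (hF₂ : SatisfiesFE F L₂)
    (hF : F.K ≠ 0 ∨ 1 < F.Q) {κ δ : ℝ} (hκ : 0 < κ) (hδ : 0 < δ) :
    ∃ c > 0, ∃ R : ℝ, ∀ r ≥ R, ∀ v : ℂ, ‖v‖ = 1 → κ ≤ v.im → v.im + κ ≤ -v.re → ∀ f : ℂ,
      δ * (‖f‖ + 1) ≤ ‖f - 1‖ →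
      Real.exp (c * r) / 2 * ‖f - 1‖ ≤ ‖f * L₂ (r * v) - L₁ (r * v)‖ := by
  obtain ⟨c, hc, R, hR⟩ := F.exists_exp_mul_le hF hκ
  obtain ⟨σ₁, hσ₁⟩ := hL₁.exists_norm_sub_one_le_of_pos (half_pos hδ)
  obtain ⟨σ₂, hσ₂⟩ := hL₂.exists_norm_sub_one_le_of_pos (half_pos hδ)
  refine ⟨c, hc, max (max R 1) (max (σ₁ / κ) (σ₂ / κ)), fun r hr v hv him hre f hf => ?_⟩
  have hrR : R ≤ r := (le_max_left _ _).trans ((le_max_left _ _).trans hr)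
  have hr1 : 1 ≤ r := (le_max_right _ _).trans ((le_max_left _ _).trans hr)
  have hr2 : σ₁ / κ ≤ r := (le_max_left _ _).trans ((le_max_right _ _).trans hr)
  have hr3 : σ₂ / κ ≤ r := (le_max_right _ _).trans ((le_max_right _ _).trans hr)
  rw [div_le_iff₀ hκ] at hr2 hr3
  have hmain := hR r hrR v hv him hre
  set s := (r : ℂ) * v with hs
  have hsre : s.re = r * v.re := by simp [hs]
  have hsneg : s.re ≤ -(r * κ) := by rw [hsre]; nlinarith
  have hsneg' : s.re < 0 := by nlinarith
  have h0 : s ≠ 0 := by rintro h; rw [h] at hsneg'; simp at hsneg'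
  have h1 : s ≠ 1 := by rintro h; rw [h] at hsneg'; norm_num at hsneg'
  have e1 := hF₁.eq hL₁ h0 h1
  have e2 := hF₂.eq hL₂ h0 h1
  set A := (F.Q : ℂ) ^ s * F.invGammaDual s with hA
  set B := (F.Q : ℂ) ^ (1 - s) * F.invGamma s with hB
  set l₁ := conj (L₁ (1 - conj s))
  set l₂ := conj (L₂ (1 - conj s))
  have hl₁ : ‖l₁ - 1‖ ≤ δ / 2 := by
    have h := hσ₁ (1 - conj s) (by simp; linarith)
    rw [← Complex.norm_conj] at h
    simpa [l₁] using h
  have hl₂ : ‖l₂ - 1‖ ≤ δ / 2 := by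
    have h := hσ₂ (1 - conj s) (by simp; linarith)
    rw [← Complex.norm_conj] at h
    simpa [l₂] using h
  have hAne : A ≠ 0 := by
    have hQ : (F.Q : ℂ) ≠ 0 := by exact_mod_cast F.Q_pos.ne'
    exact mul_ne_zero (by simp [Complex.cpow_eq_zero_iff, hQ])
      (F.invGammaDual_ne_zero (by linarith))
  have hfe : (f * L₂ s - L₁ s) * A = F.omega * (f * l₂ - l₁) * B := by
    rw [hA, hB]
    linear_combination f * e2 - e1
  have hlow : ‖f - 1‖ / 2 ≤ ‖f * l₂ - l₁‖ := by
    have e : f - 1 = (f * l₂ - l₁) - f * (l₂ - 1) + (l₁ - 1) := by ring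
    have h2 : ‖f - 1‖ ≤ ‖f * l₂ - l₁‖ + ‖f‖ * (δ / 2) + δ / 2 := by
      calc ‖f - 1‖ ≤ ‖(f * l₂ - l₁) - f * (l₂ - 1)‖ + ‖l₁ - 1‖ := by
            conv_lhs => rw [e]
            exact norm_add_le _ _
        _ ≤ ‖f * l₂ - l₁‖ + ‖f * (l₂ - 1)‖ + ‖l₁ - 1‖ := by gcongr; exact norm_sub_le _ _
        _ ≤ _ := by rw [norm_mul]; gcongr
    linarith
  have hApos : 0 < ‖A‖ := norm_pos_iff.2 hAne
  refine le_of_mul_le_mul_right ?_ hApos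
  have hfe' : ‖f * L₂ s - L₁ s‖ * ‖A‖ = ‖f * l₂ - l₁‖ * ‖B‖ := by
    rw [← norm_mul (f * L₂ s - L₁ s) A, hfe, norm_mul (F.omega * (f * l₂ - l₁)),
      norm_mul F.omega, F.norm_omega, one_mul]
  rw [hfe']
  calc Real.exp (c * r) / 2 * ‖f - 1‖ * ‖A‖ = ‖f - 1‖ / 2 * (Real.exp (c * r) * ‖A‖) := by ring
    _ ≤ ‖f * l₂ - l₁‖ * ‖B‖ := by gcongr

/-- Directions in the left half-plane that avoid the real axis and a given line. -/
lemma exists_sector (a : ℂ) : ∃ κ > 0, ∃ α β : ℝ, 0 ≤ α ∧ α < β ∧ β ≤ 2 * Real.pi ∧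
    ∀ θ ∈ Set.Icc α β, κ ≤ (exp (θ * I)).im ∧ (exp (θ * I)).im + κ ≤ -(exp (θ * I)).re ∧
      (a ≠ 0 → κ ≤ |(a * exp (θ * I)).re|) := by
  have hpi := Real.pi_pos
  have htrig : ∀ θ : ℝ, 3 * Real.pi / 4 < θ → θ < Real.pi →
      0 < (exp (θ * I)).im ∧ (exp (θ * I)).im < -(exp (θ * I)).re := by
    intro θ h1 h2
    rw [Complex.exp_ofReal_mul_I_im, Complex.exp_ofReal_mul_I_re]
    refine ⟨Real.sin_pos_of_pos_of_lt_pi (by linarith) h2, ?_⟩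
    rw [← Real.sin_pi_sub, ← Real.cos_pi_sub, ← Real.cos_pi_div_two_sub]
    exact Real.cos_lt_cos_of_nonneg_of_le_pi (by linarith) (by linarith) (by linarith)
  -- of the two directions `5π/6` and `11π/12`, at most one is orthogonal to `conj a`
  obtain ⟨θ₀, h1, h2, h3⟩ : ∃ θ₀ : ℝ, 3 * Real.pi / 4 < θ₀ ∧ θ₀ < Real.pi ∧
      (a ≠ 0 → (a * exp (θ₀ * I)).re ≠ 0) := by
    by_cases h5 : (a * exp ((5 * Real.pi / 6 : ℝ) * I)).re = 0
    · refine ⟨11 * Real.pi / 12, by linarith, by linarith, fun ha h11 => ha ?_⟩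
      rw [Complex.mul_re, Complex.exp_ofReal_mul_I_im, Complex.exp_ofReal_mul_I_re] at h5 h11
      have hsin : 0 < Real.sin (11 * Real.pi / 12 - 5 * Real.pi / 6) :=
        Real.sin_pos_of_pos_of_lt_pi (by linarith) (by linarith)
      rw [Real.sin_sub] at hsin
      refine Complex.ext ?_ ?_
      · refine (mul_eq_zero.1 (?_ : a.re * (Real.sin (11 * Real.pi / 12) *
          Real.cos (5 * Real.pi / 6) - Real.cos (11 * Real.pi / 12) *
          Real.sin (5 * Real.pi / 6)) = 0)).resolve_right hsin.ne'
        linear_combination Real.sin (11 * Real.pi / 12) * h5 - Real.sin (5 * Real.pi / 6) * h11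
      · refine (mul_eq_zero.1 (?_ : a.im * (Real.sin (11 * Real.pi / 12) *
          Real.cos (5 * Real.pi / 6) - Real.cos (11 * Real.pi / 12) *
          Real.sin (5 * Real.pi / 6)) = 0)).resolve_right hsin.ne'
        linear_combination Real.cos (11 * Real.pi / 12) * h5 - Real.cos (5 * Real.pi / 6) * h11
    · exact ⟨5 * Real.pi / 6, by linarith, by linarith, fun _ => h5⟩
  obtain ⟨h4, h5⟩ := htrig θ₀ h1 h2
  obtain ⟨κ, hκ, k1, k2, k3⟩ : ∃ κ > 0, κ < (exp (θ₀ * I)).im ∧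
      (exp (θ₀ * I)).im + κ < -(exp (θ₀ * I)).re ∧ (a ≠ 0 → κ < |(a * exp (θ₀ * I)).re|) := by
    by_cases ha : a = 0
    · refine ⟨min (exp (θ₀ * I)).im (-(exp (θ₀ * I)).re - (exp (θ₀ * I)).im) / 2, ?_, ?_, ?_,
        fun h => absurd ha h⟩
      · exact half_pos (lt_min h4 (by linarith))
      · linarith [min_le_left (exp (θ₀ * I)).im (-(exp (θ₀ * I)).re - (exp (θ₀ * I)).im)]
      · linarith [min_le_right (exp (θ₀ * I)).im (-(exp (θ₀ * I)).re - (exp (θ₀ * I)).im)]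
    · have h6 := abs_pos.2 (h3 ha)
      set x := min (exp (θ₀ * I)).im (-(exp (θ₀ * I)).re - (exp (θ₀ * I)).im) with hx
      have hx0 : 0 < x := lt_min h4 (by linarith)
      have hx1 : x ≤ _ := min_le_left _ _
      have hx2 : x ≤ _ := min_le_right _ _
      set y := min x |(a * exp (θ₀ * I)).re| with hy
      have hy0 : 0 < y := lt_min hx0 h6
      have hy1 : y ≤ x := min_le_left _ _
      have hy2 : y ≤ _ := min_le_right _ _
      exact ⟨y / 2, by linarith, by linarith, by linarith, fun _ => by linarith⟩
  have hcexp : Continuous fun θ : ℝ => exp (θ * I) := by fun_prop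
  have c1 : Continuous fun θ : ℝ => (exp (θ * I)).im := Complex.continuous_im.comp hcexp
  have c2 : Continuous fun θ : ℝ => (exp (θ * I)).re := Complex.continuous_re.comp hcexp
  have c3 : Continuous fun θ : ℝ => |(a * exp (θ * I)).re| :=
    (Complex.continuous_re.comp (continuous_const.mul hcexp)).abs
  have hev : ∀ᶠ θ : ℝ in 𝓝 θ₀, κ ≤ (exp (θ * I)).im ∧
      (exp (θ * I)).im + κ ≤ -(exp (θ * I)).re ∧ (a ≠ 0 → κ ≤ |(a * exp (θ * I)).re|) := by
    have e1 := (continuousAt_const.eventually_lt c1.continuousAt k1)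
    have e2 := ((c1.add continuous_const).continuousAt.eventually_lt c2.neg.continuousAt k2)
    have e3 : ∀ᶠ θ : ℝ in 𝓝 θ₀, a ≠ 0 → κ ≤ |(a * exp (θ * I)).re| := by
      by_cases ha : a = 0
      · exact Eventually.of_forall fun _ h => absurd ha h
      · exact (continuousAt_const.eventually_lt c3.continuousAt (k3 ha)).mono fun _ h _ => h.le
    filter_upwards [e1, e2, e3] with θ x1 x2 x3
    exact ⟨x1.le, x2.le, x3⟩
  obtain ⟨η, hη, hball⟩ := Metric.eventually_nhds_iff.1 hev
  refine ⟨κ, hκ, θ₀, θ₀ + min (η / 2) (Real.pi), by linarith, ?_, ?_, fun θ hθ => hball ?_⟩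
  · linarith [lt_min (half_pos hη) hpi]
  · linarith [min_le_right (η / 2) Real.pi]
  · rw [Real.dist_eq, abs_lt]
    have := min_le_left (η / 2) Real.pi
    constructor <;> linarith [hθ.1, hθ.2]

lemma half_mul_norm_add_one_le {f : ℂ} (h : 3 ≤ ‖f‖ ∨ ‖f‖ ≤ 1 / 3) :
    1 / 2 * (‖f‖ + 1) ≤ ‖f - 1‖ := by
  have h1 := norm_sub_norm_le f 1
  have h2 := norm_sub_norm_le 1 f
  rw [norm_sub_rev] at h2
  rw [norm_one] at h1 h2
  rcases h with h | h <;> linarith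

/-- A number whose modulus is far from `1` on the logarithmic scale stays away from `1`. -/
lemma half_mul_norm_add_one_le_of_log {f : ℂ} (hf : f ≠ 0) (h : 2 ≤ |Real.log ‖f‖|) :
    1 / 2 * (‖f‖ + 1) ≤ ‖f - 1‖ := by
  have hpos : 0 < ‖f‖ := norm_pos_iff.2 hf
  have he := Real.add_one_le_exp (2 : ℝ)
  refine half_mul_norm_add_one_le ?_
  rcases le_abs.1 h with h | h
  · left
    have := (Real.le_log_iff_exp_le hpos).1 h
    linarith
  · right
    have h1 : Real.log ‖f‖ ≤ -2 := by linarith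
    have h2 := (Real.log_le_iff_le_exp hpos).1 h1
    refine h2.trans ?_
    rw [Real.exp_neg, one_div]
    exact inv_anti₀ (by norm_num) (by linarith)

/-- In a suitable sector of the left half-plane, `(s - 1) ^ n * exp (p s)`, with `p` of degree at
most one, stays away from `1`: it tends to `0`, tends to `∞`, or is a constant other than `1`. -/
lemma exists_sector_norm_sub_one_ge (n : ℤ) (p : ℂ[X]) (hp : p.natDegree ≤ 1)
    (hne : ∃ s : ℂ, s ≠ 1 ∧ (s - 1) ^ n * exp (p.eval s) ≠ 1) :
    ∃ κ > 0, ∃ δ > 0, ∃ α β : ℝ, 0 ≤ α ∧ α < β ∧ β ≤ 2 * Real.pi ∧ ∃ R : ℝ, ∀ r ≥ R,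
      ∀ θ ∈ Set.Icc α β, κ ≤ (exp (θ * I)).im ∧ (exp (θ * I)).im + κ ≤ -(exp (θ * I)).re ∧
        δ * (‖((r * exp (θ * I) - 1) ^ n * exp (p.eval (r * exp (θ * I))) : ℂ)‖ + 1) ≤
          ‖((r * exp (θ * I) - 1) ^ n * exp (p.eval (r * exp (θ * I))) : ℂ) - 1‖ := by
  obtain ⟨a, b, rfl⟩ := Polynomial.exists_eq_X_add_C_of_natDegree_le_one hp
  simp only [eval_add, eval_mul, eval_C, eval_X] at hne ⊢
  obtain ⟨κ, hκ, α, β, hα, hαβ, hβ, hsec⟩ := exists_sector a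
  by_cases htriv : a = 0 ∧ n = 0
  · obtain ⟨rfl, rfl⟩ := htriv
    obtain ⟨s, -, hs⟩ := hne
    simp only [zpow_zero, zero_mul, zero_add, one_mul] at hs ⊢
    have h1 : 0 < ‖exp b - 1‖ := norm_pos_iff.2 (sub_ne_zero.2 hs)
    refine ⟨κ, hκ, ‖exp b - 1‖ / (‖exp b‖ + 1), by positivity, α, β, hα, hαβ, hβ, 0,
      fun r _ θ hθ => ⟨(hsec θ hθ).1, (hsec θ hθ).2.1, ?_⟩⟩
    rw [div_mul_cancel₀ _ (by positivity)]
  · have hev : ∀ᶠ r : ℝ in atTop, (a ≠ 0 → 2 + |(n : ℝ)| * Real.log (r + 1) + |b.re| ≤ κ * r) ∧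
        (n ≠ 0 → 2 + |b.re| ≤ Real.log (r - 1)) ∧ 3 ≤ r := by
      have e1 : ∀ᶠ r : ℝ in atTop, 2 + |(n : ℝ)| * Real.log (r + 1) + |b.re| ≤ κ * r := by
        have t1 : (fun r : ℝ => 2 + |(n : ℝ)| * Real.log (r + 1) + |b.re|) =o[atTop]
            fun r : ℝ => r := by
          have hlog : (fun r : ℝ => Real.log (r + 1)) =o[atTop] fun r : ℝ => r := by
            have h1 := Real.isLittleO_log_id_atTop.comp_tendsto
              (tendsto_atTop_add_const_right atTop (1 : ℝ) tendsto_id)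
            refine h1.trans_isBigO ?_
            refine IsBigO.of_bound 2 ?_
            filter_upwards [eventually_ge_atTop 1] with r hr
            simp only [Function.comp_apply, id]
            rw [Real.norm_of_nonneg (by linarith), Real.norm_of_nonneg (by linarith)]
            linarith
          exact ((isLittleO_const_id_atTop (2 : ℝ)).add (hlog.const_mul_left _)).add
            (isLittleO_const_id_atTop _)
        filter_upwards [t1.def hκ, eventually_ge_atTop 0] with r h1 h2
        rw [Real.norm_of_nonneg h2] at h1
        exact (le_abs_self _).trans h1
      have e2 : ∀ᶠ r : ℝ in atTop, 2 + |b.re| ≤ Real.log (r - 1) :=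
        (Real.tendsto_log_atTop.comp
          (tendsto_atTop_add_const_right atTop (-1 : ℝ) tendsto_id)).eventually_ge_atTop _
      filter_upwards [e1, e2, eventually_ge_atTop 3] with r h1 h2 h3
      exact ⟨fun _ => h1, fun _ => h2, h3⟩
    obtain ⟨R, hR⟩ := eventually_atTop.1 hev
    refine ⟨κ, hκ, 1 / 2, by norm_num, α, β, hα, hαβ, hβ, R, fun r hr θ hθ => ?_⟩
    obtain ⟨k1, k2, k3⟩ := hsec θ hθ
    refine ⟨k1, k2, ?_⟩
    obtain ⟨r1, r2, r3⟩ := hR r hr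
    have hnorm : ‖(r : ℂ) * exp (θ * I)‖ = r := by
      rw [norm_mul, Complex.norm_exp_ofReal_mul_I, mul_one, Complex.norm_real,
        Real.norm_of_nonneg (by linarith)]
    set s := (r : ℂ) * exp (θ * I) with hs
    have hlo : r - 1 ≤ ‖s - 1‖ := by
      have := norm_sub_norm_le s 1
      rwa [hnorm, norm_one] at this
    have hup : ‖s - 1‖ ≤ r + 1 := by
      have := norm_sub_le s 1
      rwa [hnorm, norm_one] at this
    have hs1 : s - 1 ≠ 0 := norm_pos_iff.1 (by linarith)
    refine half_mul_norm_add_one_le_of_log (mul_ne_zero (zpow_ne_zero n hs1) (exp_ne_zero _)) ?_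
    have hlogeq : Real.log ‖(s - 1) ^ n * exp (a * s + b)‖ =
        n * Real.log ‖s - 1‖ + r * (a * exp (θ * I)).re + b.re := by
      rw [norm_mul, norm_zpow, Real.log_mul (zpow_ne_zero n (norm_ne_zero_iff.2 hs1))
        (norm_ne_zero_iff.2 (exp_ne_zero _)), Real.log_zpow, Complex.norm_exp, Real.log_exp]
      have : a * s = (r : ℂ) * (a * exp (θ * I)) := by rw [hs]; ring
      rw [this, Complex.add_re, Complex.re_ofReal_mul]
      ring
    have hlog0 : 0 ≤ Real.log ‖s - 1‖ := Real.log_nonneg (by linarith)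
    have hlog1 : Real.log ‖s - 1‖ ≤ Real.log (r + 1) := Real.log_le_log (by linarith) hup
    have hlog2 : Real.log (r - 1) ≤ Real.log ‖s - 1‖ := Real.log_le_log (by linarith) hlo
    rw [hlogeq]
    have hb := abs_le.1 (le_refl |b.re|)
    by_cases ha : a = 0
    · have hn : n ≠ 0 := fun h => htriv ⟨ha, h⟩
      have h1 := r2 hn
      have hn1 : (1 : ℝ) ≤ |(n : ℝ)| := by exact_mod_cast Int.one_le_abs hn
      have e : (n : ℝ) * Real.log ‖s - 1‖ + r * (a * exp (θ * I)).re + b.re =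
        n * Real.log ‖s - 1‖ + b.re := by simp [ha]
      rw [e]
      have h2 := abs_sub_abs_le_abs_sub ((n : ℝ) * Real.log ‖s - 1‖) (-b.re)
      rw [sub_neg_eq_add, abs_neg, abs_mul, abs_of_nonneg hlog0] at h2
      nlinarith
    · have h1 := r1 ha
      have h2 := abs_sub_abs_le_abs_sub (r * (a * exp (θ * I)).re)
        (-((n : ℝ) * Real.log ‖s - 1‖ + b.re))
      rw [abs_neg, sub_neg_eq_add, abs_mul, abs_of_nonneg (by linarith : 0 ≤ r)] at h2
      have h3 : |(n : ℝ) * Real.log ‖s - 1‖ + b.re| ≤ |(n : ℝ)| * Real.log (r + 1) + |b.re| := by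
        refine (abs_add_le _ _).trans ?_
        rw [abs_mul, abs_of_nonneg hlog0]
        gcongr
      have h4 : κ * r ≤ r * |(a * exp (θ * I)).re| := by
        rw [mul_comm]
        have := k3 ha
        gcongr
      have e : (n : ℝ) * Real.log ‖s - 1‖ + r * (a * exp (θ * I)).re + b.re =
        r * (a * exp (θ * I)).re + ((n : ℝ) * Real.log ‖s - 1‖ + b.re) := by ring
      rw [e]
      linarith

lemma mul_sub_le_circleAverage {f : ℂ → ℝ} {r α β M : ℝ} (hf : CircleIntegrable f 0 r)
    (h0 : ∀ z, 0 ≤ f z) (hα : 0 ≤ α) (hαβ : α ≤ β) (hβ : β ≤ 2 * Real.pi)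
    (hM : ∀ θ ∈ Set.Icc α β, M ≤ f (circleMap 0 r θ)) :
    (2 * Real.pi)⁻¹ * (β - α) * M ≤ Real.circleAverage f 0 r := by
  rw [Real.circleAverage_def, smul_eq_mul, mul_assoc]
  have hpi := Real.pi_pos
  gcongr
  have h1 : ∫ θ in α..β, M ≤ ∫ θ in α..β, f (circleMap 0 r θ) := by
    refine intervalIntegral.integral_mono_on hαβ intervalIntegrable_const ?_ hM
    exact IntervalIntegrable.mono_set hf (by
      rw [Set.uIcc_of_le hαβ, Set.uIcc_of_le (by positivity)]
      exact Set.Icc_subset_Icc hα hβ)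
  rw [intervalIntegral.integral_const, smul_eq_mul] at h1
  refine h1.trans ?_
  exact intervalIntegral.integral_mono_interval hα hαβ hβ
    (Eventually.of_forall fun θ => h0 _) hf

end MovingTarget

/-! ### The order of the moving target -/

namespace MovingTarget

open Asymptotics Topology Complex ValueDistribution

lemma eventually_codiscrete_ne_zero {f : ℂ → ℂ} (hf : Meromorphic f) {w : ℂ}
    (hw : ContinuousAt f w) (h0 : f w ≠ 0) : ∀ᶠ z in codiscrete ℂ, f z ≠ 0 := by
  refine MeromorphicOn.eventually_codiscreteWithin_apply_ne_zero (U := Set.univ)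
    hf.meromorphicOn fun z _ hz => h0 ?_
  exact eq_of_eventuallyEq_codiscrete (eventuallyEq_zero_codiscrete hf hz) hw continuousAt_const

lemma growthOrder_congr {f g : ℂ → ℂ} (h : f =ᶠ[codiscrete ℂ] g) :
    growthOrder f = growthOrder g := by
  refine limsup_congr ?_
  filter_upwards [eventually_ne_atTop 0] with r hr
  rw [characteristic_congr_codiscrete h hr]

lemma meromorphic_sub_one_zpow (n : ℤ) : Meromorphic fun s : ℂ => (s - 1) ^ n :=
  fun _ => by fun_prop

lemma differentiable_exp_polynomial (p : ℂ[X]) : Differentiable ℂ fun s => exp (p.eval s) := by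
  fun_prop

lemma meromorphic_multiplier (n : ℤ) (p : ℂ[X]) :
    Meromorphic fun s : ℂ => (s - 1) ^ n * exp (p.eval s) := fun s =>
  (meromorphic_sub_one_zpow n s).mul
    (meromorphic_of_differentiable (differentiable_exp_polynomial p) s)

variable {L₁ L₂ : ℂ → ℂ} {F : FEData}

lemma eventually_ne_of_isLFunction (hL₁ : IsLFunction L₁) (hL₂ : IsLFunction L₂)
    (hne : ∃ s, s ≠ 1 ∧ L₁ s ≠ L₂ s) : ∀ᶠ s in codiscrete ℂ, L₁ s ≠ L₂ s := by
  obtain ⟨w, hw, h⟩ := hne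
  filter_upwards [eventually_codiscrete_ne_zero (f := fun s => L₁ s - L₂ s) (w := w)
    (fun s => (hL₁.meromorphic s).fun_sub (hL₂.meromorphic s))
    ((hL₁.differentiableAt hw).continuousAt.sub (hL₂.differentiableAt hw).continuousAt)
    (sub_ne_zero.2 h)] with s hs
  exact sub_ne_zero.1 hs

lemma eventually_multiplier_ne_one {n : ℤ} {p : ℂ[X]}
    (hΦ : ∃ s : ℂ, s ≠ 1 ∧ (s - 1) ^ n * exp (p.eval s) ≠ 1) :
    ∀ᶠ s in codiscrete ℂ, (s - 1) ^ n * exp (p.eval s) ≠ 1 := by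
  obtain ⟨w, hw, h⟩ := hΦ
  filter_upwards [eventually_codiscrete_ne_zero
    (f := fun s => (s - 1) ^ n * exp (p.eval s) - 1) (w := w)
    (fun s => (meromorphic_multiplier n p s).fun_sub (MeromorphicAt.const 1 s))
    ((ContinuousAt.mul ((by fun_prop : ContinuousAt (fun s : ℂ => s - 1) w).zpow₀ n
      (Or.inl (sub_ne_zero.2 hw))) (by fun_prop)).sub continuousAt_const)
    (sub_ne_zero.2 h)] with s hs
  exact sub_ne_zero.1 hs

lemma meromorphic_movingTarget {Φ : ℂ → ℂ} (hL₁ : IsLFunction L₁) (hL₂ : IsLFunction L₂)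
    (hΦ : Meromorphic Φ) : Meromorphic fun s => (Φ s * L₂ s - L₁ s) / (Φ s - 1) := fun s =>
  (((hΦ s).fun_mul (hL₂.meromorphic s)).fun_sub (hL₁.meromorphic s)).fun_div
    ((hΦ s).fun_sub (MeromorphicAt.const 1 s))

/-- The target `(Φ L₂ - L₁) / (Φ - 1)` determines its multiplier `Φ`. -/
lemma eventuallyEq_multiplier {Φ h : ℂ → ℂ} (hne : ∀ᶠ s in codiscrete ℂ, L₁ s ≠ L₂ s)
    (hΦ : ∀ᶠ s in codiscrete ℂ, Φ s ≠ 1)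
    (hh : h =ᶠ[codiscrete ℂ] fun s => (Φ s * L₂ s - L₁ s) / (Φ s - 1)) :
    (fun s => (h s - L₁ s) / (h s - L₂ s)) =ᶠ[codiscrete ℂ] Φ := by
  filter_upwards [hne, hΦ, hh] with s h1 h2 h3
  have h2' : Φ s - 1 ≠ 0 := sub_ne_zero.2 h2
  have h1' : L₂ s - L₁ s ≠ 0 := sub_ne_zero.2 (Ne.symm h1)
  have e1 : h s - L₁ s = Φ s * (L₂ s - L₁ s) / (Φ s - 1) := by
    rw [h3]; field_simp; ring
  have e2 : h s - L₂ s = (L₂ s - L₁ s) / (Φ s - 1) := by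
    rw [h3]; field_simp; ring
  rw [e1, e2]
  field_simp

lemma HasOrderLE.multiplier {h : ℂ → ℂ} {ρ : ℝ} (hρ : 1 ≤ ρ) (mh : Meromorphic h)
    (hh : HasOrderLE h ρ) (hL₁ : IsLFunction L₁) (hL₂ : IsLFunction L₂) :
    HasOrderLE (fun s => (h s - L₁ s) / (h s - L₂ s)) ρ := by
  have hρ0 : 0 ≤ ρ := by linarith
  exact ((hh.sub mh hL₁.meromorphic hρ0 (hL₁.hasOrderLE.mono hρ)).div
    (fun s => (mh s).sub (hL₁.meromorphic s)) (fun s => (mh s).sub (hL₂.meromorphic s)) hρ0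
    (hh.sub mh hL₂.meromorphic hρ0 (hL₂.hasOrderLE.mono hρ)))

lemma HasOrderLE.movingTarget {Φ : ℂ → ℂ} {ρ : ℝ} (hρ : 1 ≤ ρ) (mΦ : Meromorphic Φ)
    (hΦ : HasOrderLE Φ ρ) (hL₁ : IsLFunction L₁) (hL₂ : IsLFunction L₂) :
    HasOrderLE (fun s => (Φ s * L₂ s - L₁ s) / (Φ s - 1)) ρ := by
  have hρ0 : 0 ≤ ρ := by linarith
  exact ((hΦ.mul mΦ hL₂.meromorphic (hL₂.hasOrderLE.mono hρ)).sub
      (fun s => (mΦ s).mul (hL₂.meromorphic s)) hL₁.meromorphic hρ0 (hL₁.hasOrderLE.mono hρ)).div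
    (fun s => ((mΦ s).mul (hL₂.meromorphic s)).sub (hL₁.meromorphic s))
    (fun s => (mΦ s).sub (MeromorphicAt.const 1 s)) hρ0
    (hΦ.sub mΦ (fun s => MeromorphicAt.const 1 s) hρ0 (hasOrderLE_const 1 hρ0))

lemma hasOrderLE_multiplier (n : ℤ) (p : ℂ[X]) :
    HasOrderLE (fun s : ℂ => (s - 1) ^ n * exp (p.eval s)) p.natDegree :=
  ((hasOrderLE_sub_one_zpow n).mono (Nat.cast_nonneg _)).mul (meromorphic_sub_one_zpow n)
    (meromorphic_of_differentiable (differentiable_exp_polynomial p)) (hasOrderLE_exp_polynomial p)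

lemma natDegree_le_of_hasOrderLE_multiplier {n : ℤ} {p : ℂ[X]} {ρ : ℝ} (hρ : 0 ≤ ρ)
    (h : HasOrderLE (fun s : ℂ => (s - 1) ^ n * exp (p.eval s)) ρ) : (p.natDegree : ℝ) ≤ ρ := by
  refine HasOrderLE.natDegree_le hρ ?_
  refine (((hasOrderLE_sub_one_zpow (-n)).mono hρ).mul (meromorphic_sub_one_zpow (-n))
    (meromorphic_multiplier n p) h).congr ?_
  filter_upwards [compl_singleton_mem_codiscrete 1] with s hs
  have h1 : s - 1 ≠ 0 := sub_ne_zero.2 hs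
  simp [zpow_neg, zpow_ne_zero n h1]

/-- The proximity function of the target grows at least linearly when the multiplier has order at
most one: in a sector of the left half-plane the functional equation makes the target large. -/
lemma one_le_growthOrder_movingTarget (hL₁ : IsLFunction L₁) (hL₂ : IsLFunction L₂)
    (hF₁ : SatisfiesFE F L₁) (hF₂ : SatisfiesFE F L₂) (hF : F.K ≠ 0 ∨ 1 < F.Q)
    {n : ℤ} {p : ℂ[X]} (hp : p.natDegree ≤ 1)
    (hΦ : ∃ s : ℂ, s ≠ 1 ∧ (s - 1) ^ n * exp (p.eval s) ≠ 1) :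
    1 ≤ growthOrder fun s => ((s - 1) ^ n * exp (p.eval s) * L₂ s - L₁ s) /
      ((s - 1) ^ n * exp (p.eval s) - 1) := by
  obtain ⟨κ, hκ, δ, hδ, α, β, hα, hαβ, hβ, R₁, hsec⟩ := exists_sector_norm_sub_one_ge n p hp hΦ
  obtain ⟨c, hc, R₂, hlow⟩ := exists_norm_mul_sub_ge hL₁ hL₂ hF₁ hF₂ hF hκ hδ
  set H : ℂ → ℂ := fun s => ((s - 1) ^ n * exp (p.eval s) * L₂ s - L₁ s) /
      ((s - 1) ^ n * exp (p.eval s) - 1) with hH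
  have mH : Meromorphic H := meromorphic_movingTarget hL₁ hL₂ (meromorphic_multiplier n p)
  have hpi := Real.pi_pos
  have hβα : 0 < β - α := sub_pos.2 hαβ
  refine le_growthOrder_of_eventually_le (ρ := 1) (c := (2 * Real.pi)⁻¹ * (β - α) * (c / 2))
    (by positivity) ?_
  filter_upwards [eventually_ge_atTop R₁, eventually_ge_atTop R₂, eventually_ge_atTop 1,
    eventually_ge_atTop (2 * Real.log 2 / c)] with r h1 h2 h3 h4
  rw [div_le_iff₀ hc] at h4
  have hci : CircleIntegrable (fun z => Real.posLog ‖H z‖) 0 r :=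
    mH.meromorphicOn.circleIntegrable_posLog_norm
  have hprox : (2 * Real.pi)⁻¹ * (β - α) * (c * r - Real.log 2) ≤ proximity H ⊤ r := by
    rw [proximity_top]
    refine mul_sub_le_circleAverage hci (fun z => Real.posLog_nonneg) hα hαβ.le hβ ?_
    intro θ hθ
    obtain ⟨k1, k2, k3⟩ := hsec r h1 θ hθ
    have k4 := hlow r h2 (exp (θ * I)) (norm_exp_ofReal_mul_I θ) k1 k2 _ k3
    have hz : circleMap 0 r θ = r * exp (θ * I) := by simp [circleMap]
    have hpos : 0 < ‖((r * exp (θ * I) - 1) ^ n * exp (p.eval (r * exp (θ * I))) : ℂ) - 1‖ :=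
      lt_of_lt_of_le (by positivity) k3
    have k5 : Real.exp (c * r) / 2 ≤ ‖H (circleMap 0 r θ)‖ := by
      rw [hz, hH]
      simp only [norm_div]
      rwa [le_div_iff₀ hpos]
    calc c * r - Real.log 2 = Real.log (Real.exp (c * r) / 2) := by
          rw [Real.log_div (Real.exp_pos _).ne' two_ne_zero, Real.log_exp]
      _ ≤ Real.log ‖H (circleMap 0 r θ)‖ := Real.log_le_log (by positivity) k5
      _ ≤ _ := le_max_right _ _
  have hN : 0 ≤ logCounting H ⊤ r := logCounting_nonneg h3
  calc (2 * Real.pi)⁻¹ * (β - α) * (c / 2) * r ^ (1 : ℝ)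
      = (2 * Real.pi)⁻¹ * (β - α) * (c / 2 * r) := by rw [Real.rpow_one]; ring
    _ ≤ (2 * Real.pi)⁻¹ * (β - α) * (c * r - Real.log 2) := by
        gcongr
        linarith
    _ ≤ proximity H ⊤ r := hprox
    _ ≤ proximity H ⊤ r + logCounting H ⊤ r := le_add_of_nonneg_right hN

/-- The moving target with multiplier `(s - 1) ^ n * exp (p s)` has order `max 1 (deg p)`. The
L-functions and the multiplier bound the order from above. If `deg p ≥ 2`, a target of smaller
order would yield a multiplier of smaller order; if `deg p ≤ 1`, the lower bound comes from the
functional equation. -/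
theorem growthOrder_movingTarget (hL₁ : IsLFunction L₁) (hL₂ : IsLFunction L₂)
    (hF₁ : SatisfiesFE F L₁) (hF₂ : SatisfiesFE F L₂) (hne : ∃ s, s ≠ 1 ∧ L₁ s ≠ L₂ s)
    {n : ℤ} {p : ℂ[X]} (hΦ : ∃ s : ℂ, s ≠ 1 ∧ (s - 1) ^ n * exp (p.eval s) ≠ 1) :
    growthOrder (fun s => ((s - 1) ^ n * exp (p.eval s) * L₂ s - L₁ s) /
      ((s - 1) ^ n * exp (p.eval s) - 1)) = (max 1 p.natDegree : ℕ) := by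
  have mΦ := meromorphic_multiplier n p
  have mH := meromorphic_movingTarget hL₁ hL₂ mΦ
  refine le_antisymm ?_ ?_
  · have h1 : (1 : ℝ) ≤ (max 1 p.natDegree : ℕ) := by exact_mod_cast le_max_left _ _
    have h2 : (p.natDegree : ℝ) ≤ (max 1 p.natDegree : ℕ) := by exact_mod_cast le_max_right _ _
    exact (HasOrderLE.movingTarget h1 mΦ ((hasOrderLE_multiplier n p).mono h2) hL₁
      hL₂).growthOrder_le (by positivity)
  · rcases le_or_gt p.natDegree 1 with hp | hp
    · -- otherwise both L-functions are the constant `1`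
      have hF : F.K ≠ 0 ∨ 1 < F.Q := by
        by_contra! hcon
        obtain ⟨s, hs, hs'⟩ := hne
        exact hs' ((hL₁.eq_one_of_K_eq_zero hF₁ hcon.1 hcon.2 hs).trans
          (hL₂.eq_one_of_K_eq_zero hF₂ hcon.1 hcon.2 hs).symm)
      rw [max_eq_left hp]
      simpa using one_le_growthOrder_movingTarget hL₁ hL₂ hF₁ hF₂ hF hp hΦ
    · rw [max_eq_right hp.le]
      by_contra! hlt
      obtain ⟨x, hx1, hx2⟩ := EReal.lt_iff_exists_real_btwn.1 hlt
      have hx2' : x < p.natDegree := by exact_mod_cast hx2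
      have hρ : HasOrderLE _ (max 1 x) :=
        (hasOrderLE_of_growthOrder_lt hx1).mono (le_max_right _ _)
      have h1 := (HasOrderLE.multiplier (le_max_left _ _) mH hρ hL₁ hL₂).congr
        (eventuallyEq_multiplier (eventually_ne_of_isLFunction hL₁ hL₂ hne)
          (eventually_multiplier_ne_one hΦ) EventuallyEq.rfl)
      have h2 := natDegree_le_of_hasOrderLE_multiplier (by positivity) h1
      have h3 : max 1 x < (p.natDegree : ℝ) := max_lt (by exact_mod_cast hp) hx2'
      linarith

end MovingTarget

/-! ### Uniqueness -/

namespace MovingTarget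

open Asymptotics Topology Complex ValueDistribution

/-- A meromorphic function on the plane without zeros and poles is the exponential of an entire
function. -/
lemma exists_eventuallyEq_exp {f : ℂ → ℂ} (hf : Meromorphic f)
    (h : ∀ z, meromorphicOrderAt f z = 0) :
    ∃ g : ℂ → ℂ, Differentiable ℂ g ∧ f =ᶠ[codiscrete ℂ] fun z => exp (g z) := by
  have hfU : MeromorphicOn f Set.univ := hf.meromorphicOn
  have hE := meromorphicNFOn_toMeromorphicNFOn f Set.univ
  have hord : ∀ z, meromorphicOrderAt (toMeromorphicNFOn f Set.univ) z = 0 := fun z => by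
    rw [meromorphicOrderAt_congr (hfU.toMeromorphicNFOn_eq_self_on_nhdsNE (Set.mem_univ z)), h z]
  obtain ⟨g, hg, hgE⟩ := exists_exp_eq_of_ne_zero
    (fun z => ((hE (Set.mem_univ z)).meromorphicOrderAt_nonneg_iff_analyticAt.1
      (hord z).ge).differentiableAt)
    (fun z => (hE (Set.mem_univ z)).meromorphicOrderAt_eq_zero_iff.1 (hord z))
  refine ⟨g, hg, ?_⟩
  filter_upwards [toMeromorphicNFOn_eqOn_codiscrete hfU] with z hz
  rw [hz, hgE]

/-- Two functions `l₁ - h` and `l₂ - h` with the same zeros also have the same poles wherever `l₁`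
and `l₂` are analytic: the poles there are those of `h`. -/
lemma meromorphicOrderAt_sub_eq {h l₁ l₂ : ℂ → ℂ} {z : ℂ} (mh : MeromorphicAt h z)
    (a₁ : AnalyticAt ℂ l₁ z) (a₂ : AnalyticAt ℂ l₂ z)
    (hz : max (meromorphicOrderAt (fun s => l₁ s - h s) z) 0 =
      max (meromorphicOrderAt (fun s => l₂ s - h s) z) 0) :
    meromorphicOrderAt (fun s => l₁ s - h s) z = meromorphicOrderAt (fun s => l₂ s - h s) z := by
  have e (l : ℂ → ℂ) : (fun s => l s - h s) = l + -h := by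
    funext s; simp [sub_eq_add_neg]
  rcases lt_or_ge (meromorphicOrderAt h z) 0 with hn | hp
  · have key (l : ℂ → ℂ) (a : AnalyticAt ℂ l z) :
        meromorphicOrderAt (fun s => l s - h s) z = meromorphicOrderAt h z := by
      rw [e l, meromorphicOrderAt_add_eq_right_of_lt a.meromorphicAt, ← meromorphicOrderAt_neg]
      rw [← meromorphicOrderAt_neg]
      exact hn.trans_le a.meromorphicOrderAt_nonneg
    rw [key l₁ a₁, key l₂ a₂]
  · have key (l : ℂ → ℂ) (a : AnalyticAt ℂ l z) :
        0 ≤ meromorphicOrderAt (fun s => l s - h s) z := by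
      rw [e l]
      refine le_trans (le_min a.meromorphicOrderAt_nonneg ?_)
        (meromorphicOrderAt_add a.meromorphicAt mh.neg)
      rwa [← meromorphicOrderAt_neg]
    rwa [max_eq_left (key l₁ a₁), max_eq_left (key l₂ a₂)] at hz

lemma IsLFunction.analyticAt {L : ℂ → ℂ} (hL : IsLFunction L) {s : ℂ} (hs : s ≠ 1) :
    AnalyticAt ℂ L s := by
  rw [analyticAt_iff_eventually_differentiableAt]
  filter_upwards [continuousAt_id.eventually_ne hs] with z hz
  exact hL.differentiableAt hz

variable {h L₁ L₂ : ℂ → ℂ} {F : FEData}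

/-- If `L₁ - h` and `L₂ - h` have the same zeros and `h` has finite order, the quotient of these two
functions is `(s - 1) ^ n * exp (p s)` for a polynomial `p`. -/
lemma exists_multiplier (mh : Meromorphic h) (hh : growthOrder h ≠ ⊤) (hL₁ : IsLFunction L₁)
    (hL₂ : IsLFunction L₂)
    (hz : SameZeros (fun s => L₁ s - h s) (fun s => L₂ s - h s))
    (ht₁ : ∀ z, meromorphicOrderAt (fun s => L₁ s - h s) z ≠ ⊤)
    (ht₂ : ∀ z, meromorphicOrderAt (fun s => L₂ s - h s) z ≠ ⊤) :
    ∃ (n : ℤ) (p : ℂ[X]), (fun s => (L₁ s - h s) / (L₂ s - h s)) =ᶠ[codiscrete ℂ]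
      fun s => (s - 1) ^ n * exp (p.eval s) := by
  have m₁ : Meromorphic fun s => L₁ s - h s := fun s => (hL₁.meromorphic s).fun_sub (mh s)
  have m₂ : Meromorphic fun s => L₂ s - h s := fun s => (hL₂.meromorphic s).fun_sub (mh s)
  set Φ : ℂ → ℂ := fun s => (L₁ s - h s) / (L₂ s - h s) with hΦ
  have mΦ : Meromorphic Φ := fun s => (m₁ s).fun_div (m₂ s)
  have ordΦ (z : ℂ) : meromorphicOrderAt Φ z = meromorphicOrderAt (fun s => L₁ s - h s) z -
      meromorphicOrderAt (fun s => L₂ s - h s) z := meromorphicOrderAt_div (m₁ z) (m₂ z)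
  obtain ⟨n, hn⟩ : ∃ n : ℤ, meromorphicOrderAt Φ 1 = n := by
    rw [ordΦ]
    obtain ⟨a, ha⟩ := WithTop.ne_top_iff_exists.1 (ht₁ 1)
    obtain ⟨b, hb⟩ := WithTop.ne_top_iff_exists.1 (ht₂ 1)
    exact ⟨a - b, by rw [← ha, ← hb]; rfl⟩
  -- the power of `s - 1` removes the zero or pole at the possible pole `1` of the L-functions
  have hord : ∀ z, meromorphicOrderAt (fun s => (s - 1) ^ (-n) * Φ s) z = 0 := by
    intro z
    refine (meromorphicOrderAt_mul (meromorphic_sub_one_zpow (-n) z) (mΦ z)).trans ?_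
    rcases eq_or_ne z 1 with rfl | hz1
    · have h1 : meromorphicOrderAt (fun s : ℂ => (s - 1) ^ (-n)) 1 = (-n : ℤ) :=
        meromorphicOrderAt_zpow_id_sub_const
      rw [h1, hn, ← WithTop.coe_add, neg_add_cancel]
      rfl
    · have h1 : meromorphicOrderAt (fun s : ℂ => (s - 1) ^ (-n)) z = 0 := by
        have ha : AnalyticAt ℂ (fun s : ℂ => (s - 1) ^ (-n)) z :=
          AnalyticAt.fun_zpow (by fun_prop) (sub_ne_zero.2 hz1)
        exact ha.meromorphicNFAt.meromorphicOrderAt_eq_zero_iff.2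
          (zpow_ne_zero _ (sub_ne_zero.2 hz1))
      rw [h1, ordΦ, meromorphicOrderAt_sub_eq (mh z) (hL₁.analyticAt hz1) (hL₂.analyticAt hz1)
        (hz z), zero_add]
      obtain ⟨b, hb⟩ := WithTop.ne_top_iff_exists.1 (ht₂ z)
      rw [← hb, ← WithTop.LinearOrderedAddCommGroup.coe_sub, sub_self]
      rfl
  obtain ⟨g, hg, hgE⟩ := exists_eventuallyEq_exp
    (fun s => (meromorphic_sub_one_zpow (-n) s).fun_mul (mΦ s)) hord
  obtain ⟨k, hk⟩ := exists_hasOrderLE_of_growthOrder_ne_top hh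
  have hk1 : (1 : ℝ) ≤ k + 1 := by simp
  have hΦk : HasOrderLE Φ (k + 1) := by
    refine (HasOrderLE.multiplier hk1 mh (hk.mono (by simp)) hL₁ hL₂).congr
      (Eventually.of_forall fun s => ?_)
    simp only [hΦ]
    rw [← neg_sub, ← neg_sub (L₂ s), neg_div_neg_eq]
  obtain ⟨p, hp⟩ := exists_polynomial_of_hasOrderLE_exp hg (((((hasOrderLE_sub_one_zpow (-n)).mono
    (by linarith)).mul (meromorphic_sub_one_zpow (-n)) mΦ hΦk)).congr hgE)
  refine ⟨n, p, ?_⟩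
  filter_upwards [hgE, compl_singleton_mem_codiscrete 1] with s hs hs1
  have hs1' : (s - 1) ^ n ≠ 0 := zpow_ne_zero n (sub_ne_zero.2 hs1)
  rw [← hp, ← hs, zpow_neg, mul_inv_cancel_left₀ hs1']

/-- Two distinct L-functions with the same functional equation can only share a finite-order moving
target whose order is a positive integer. -/
theorem exists_growthOrder_eq (mh : Meromorphic h) (hh : growthOrder h ≠ ⊤) (hL₁ : IsLFunction L₁)
    (hL₂ : IsLFunction L₂) (hF₁ : SatisfiesFE F L₁) (hF₂ : SatisfiesFE F L₂)
    (hz : SameZeros (fun s => L₁ s - h s) (fun s => L₂ s - h s))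
    (hne : ∃ s, s ≠ 1 ∧ L₁ s ≠ L₂ s) : ∃ n : ℕ, 0 < n ∧ growthOrder h = n := by
  have m₁ : Meromorphic fun s => L₁ s - h s := fun s => (hL₁.meromorphic s).fun_sub (mh s)
  have m₂ : Meromorphic fun s => L₂ s - h s := fun s => (hL₂.meromorphic s).fun_sub (mh s)
  have hne' := eventually_ne_of_isLFunction hL₁ hL₂ hne
  obtain ⟨w, hw, hLw⟩ := hne
  have hnot : ¬ L₁ =ᶠ[codiscrete ℂ] L₂ := fun hcon => hLw
    (eq_of_eventuallyEq_codiscrete hcon (hL₁.differentiableAt hw).continuousAt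
      (hL₂.differentiableAt hw).continuousAt)
  have htop (z : ℂ) : ¬ (meromorphicOrderAt (fun s => L₁ s - h s) z = ⊤ ∧
      meromorphicOrderAt (fun s => L₂ s - h s) z = ⊤) := by
    rintro ⟨h1, h2⟩
    refine hnot ?_
    filter_upwards [eventuallyEq_zero_codiscrete m₁ h1, eventuallyEq_zero_codiscrete m₂ h2]
      with s e1 e2
    exact (sub_eq_zero.1 e1).trans (sub_eq_zero.1 e2).symm
  have ht₁ (z : ℂ) : meromorphicOrderAt (fun s => L₁ s - h s) z ≠ ⊤ := by
    intro h1
    have h2 := hz z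
    rw [h1, max_eq_left le_top] at h2
    rcases max_choice (meromorphicOrderAt (fun s => L₂ s - h s) z) 0 with h3 | h3
    · exact htop z ⟨h1, (h2.trans h3).symm⟩
    · exact WithTop.top_ne_zero (h2.trans h3)
  have ht₂ (z : ℂ) : meromorphicOrderAt (fun s => L₂ s - h s) z ≠ ⊤ := by
    intro h1
    have h2 := hz z
    rw [h1, max_eq_left le_top] at h2
    rcases max_choice (meromorphicOrderAt (fun s => L₁ s - h s) z) 0 with h3 | h3
    · exact ht₁ z (h3.symm.trans h2)
    · exact WithTop.top_ne_zero (h2.symm.trans h3)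
  obtain ⟨n, p, hΦ⟩ := exists_multiplier mh hh hL₁ hL₂ hz ht₁ ht₂
  have h0 : ∀ᶠ s in codiscrete ℂ, L₂ s - h s ≠ 0 :=
    MeromorphicOn.eventually_codiscreteWithin_apply_ne_zero (U := Set.univ)
      m₂.meromorphicOn fun z _ => ht₂ z
  have hΦ1 : ∃ s : ℂ, s ≠ 1 ∧ (s - 1) ^ n * exp (p.eval s) ≠ 1 := by
    by_contra! hcon
    refine hnot ?_
    filter_upwards [hΦ, h0, compl_singleton_mem_codiscrete 1] with s h1 h2 h3
    rw [hcon s h3, div_eq_one_iff_eq h2] at h1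
    exact sub_left_inj.1 h1
  refine ⟨max 1 p.natDegree, by positivity, ?_⟩
  rw [← growthOrder_movingTarget hL₁ hL₂ hF₁ hF₂ ⟨w, hw, hLw⟩ hΦ1]
  refine growthOrder_congr ?_
  filter_upwards [hΦ, h0, eventually_multiplier_ne_one hΦ1] with s h1 h2 h3
  rw [eq_div_iff (sub_ne_zero.2 h3)]
  rw [div_eq_iff h2] at h1
  linear_combination h1

end MovingTarget

/-! ### Shared targets of integral and of infinite order -/

namespace MovingTarget

open Asymptotics Topology Complex ValueDistribution

/-- The Dirichlet polynomial `1 + c 2^{-s} + 2 · 4^{-s}`. For real `c` it satisfies the functional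
equation with `Q = 2`, `ω = 1` and no gamma factor. -/
noncomputable def quadraticL (c : ℝ) (s : ℂ) : ℂ :=
  1 + c * (2 : ℂ) ^ (-s) + 2 * ((2 : ℂ) ^ (-s)) ^ 2

/-- The Dirichlet coefficients of `quadraticL c`. -/
noncomputable def quadraticCoeff (c : ℝ) (n : ℕ) : ℂ :=
  if n = 1 then 1 else if n = 2 then c else if n = 4 then 2 else 0

/-- The functional equation `2^s L(s) = conj (2^{1 - conj s} L(1 - conj s))`. -/
noncomputable def quadraticFE : FEData where
  K := 0
  Q := 2
  lam := fun _ => 1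
  mu := fun _ => 0
  omega := 1
  Q_pos := two_pos
  lam_pos := fun _ => one_pos
  mu_re_nonneg := fun _ => le_rfl
  norm_omega := norm_one

lemma differentiable_two_cpow_neg : Differentiable ℂ fun s : ℂ => (2 : ℂ) ^ (-s) := fun _ =>
  (differentiableAt_id.neg).const_cpow (Or.inl two_ne_zero)

lemma differentiable_quadraticL (c : ℝ) : Differentiable ℂ (quadraticL c) :=
  ((differentiable_const _).add (differentiable_two_cpow_neg.const_mul _)).add
    ((differentiable_two_cpow_neg.pow 2).const_mul _)

lemma LSeries_quadraticCoeff (c : ℝ) (s : ℂ) : LSeries (quadraticCoeff c) s = quadraticL c s := by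
  have h4 : (4 : ℂ) ^ s = (2 : ℂ) ^ s * (2 : ℂ) ^ s := by
    have := Complex.natCast_mul_natCast_cpow 2 2 s
    norm_num at this
    exact this
  rw [LSeries, tsum_eq_sum (s := {1, 2, 4})]
  · simp [LSeries.term, quadraticCoeff, quadraticL, h4, cpow_neg]
    ring
  · intro n hn
    simp only [Finset.mem_insert, Finset.mem_singleton, not_or] at hn
    simp [LSeries.term, quadraticCoeff, hn.1, hn.2.1, hn.2.2]

lemma norm_quadraticL_le (c : ℝ) (s : ℂ) :
    ‖quadraticL c s‖ ≤ (3 + |c|) * Real.exp (2 * ‖s‖) := by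
  have hu : ‖(2 : ℂ) ^ (-s)‖ ≤ Real.exp ‖s‖ := by
    have h := Complex.norm_cpow_eq_rpow_re_of_pos two_pos (-s)
    rw [Complex.ofReal_ofNat] at h
    rw [h, Real.rpow_def_of_pos two_pos]
    refine Real.exp_le_exp.2 ?_
    have h1 : Real.log 2 ≤ 1 := by linarith [Real.log_two_lt_d9]
    have h2 : 0 ≤ Real.log 2 := Real.log_nonneg one_le_two
    have h3 : (-s).re ≤ ‖s‖ := (Complex.re_le_norm _).trans_eq (norm_neg s)
    calc Real.log 2 * (-s).re ≤ Real.log 2 * ‖s‖ := by gcongr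
      _ ≤ 1 * ‖s‖ := by gcongr
      _ = ‖s‖ := one_mul _
  have h1 : 1 ≤ Real.exp ‖s‖ := Real.one_le_exp (norm_nonneg s)
  have he : Real.exp (2 * ‖s‖) = Real.exp ‖s‖ ^ 2 := by
    rw [← Real.exp_nat_mul]; norm_num
  rw [he]
  calc ‖quadraticL c s‖ ≤ 1 + |c| * ‖(2 : ℂ) ^ (-s)‖ + 2 * ‖(2 : ℂ) ^ (-s)‖ ^ 2 := by
        refine (norm_add_le _ _).trans ?_
        gcongr
        · refine (norm_add_le _ _).trans ?_
          simp
        · simp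
    _ ≤ Real.exp ‖s‖ ^ 2 + |c| * Real.exp ‖s‖ ^ 2 + 2 * Real.exp ‖s‖ ^ 2 := by
        gcongr
        · exact one_le_pow₀ h1
        · exact hu.trans (le_self_pow₀ h1 two_ne_zero)
    _ = _ := by ring

lemma satisfiesFE_quadraticL (c : ℝ) : SatisfiesFE quadraticFE (quadraticL c) := by
  refine Eventually.of_forall fun s => ?_
  have hconj (z : ℂ) : conj ((2 : ℂ) ^ z) = (2 : ℂ) ^ conj z := by
    have h := Complex.cpow_conj 2 z (by rw [Complex.ofNat_arg]; exact Real.pi_ne_zero.symm)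
    rw [h, map_ofNat]
  have h2 : (2 : ℂ) ^ s ≠ 0 := by simp [Complex.cpow_eq_zero_iff]
  have e1 : (2 : ℂ) ^ (1 - s) = 2 * ((2 : ℂ) ^ s)⁻¹ := by
    rw [Complex.cpow_sub _ _ two_ne_zero, Complex.cpow_one, div_eq_mul_inv]
  have e2 : (2 : ℂ) ^ (-(1 - s)) = (2 : ℂ) ^ s / 2 := by
    rw [neg_sub, Complex.cpow_sub _ _ two_ne_zero, Complex.cpow_one]
  have e3 : (2 : ℂ) ^ (-s) = ((2 : ℂ) ^ s)⁻¹ := Complex.cpow_neg _ _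
  change quadraticL c s * ((2 : ℝ) : ℂ) ^ s * ∏ j : Fin 0, _ =
    1 * conj (quadraticL c (1 - conj s) * ((2 : ℝ) : ℂ) ^ (1 - conj s) * ∏ j : Fin 0, _)
  simp only [Finset.univ_eq_empty, Finset.prod_empty, mul_one, one_mul, quadraticL, map_mul,
    map_add, map_pow, map_one, hconj, Complex.ofReal_ofNat, map_sub, map_neg, Complex.conj_conj,
    Complex.conj_ofReal, map_ofNat, e1, e2, e3]
  field_simp
  ring

lemma isLFunction_quadraticL (c : ℝ) : IsLFunction (quadraticL c) where
  dirichlet_series := by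
    refine ⟨quadraticCoeff c, by simp [quadraticCoeff], fun ε _ => ?_,
      fun s _ => (LSeries_quadraticCoeff c s).symm⟩
    refine (isBigO_zero _ _).congr' ?_ EventuallyEq.rfl
    filter_upwards [eventually_gt_atTop 4] with n hn
    have h1 : n ≠ 1 := by omega
    have h2 : n ≠ 2 := by omega
    simp [quadraticCoeff, hn.ne', h1, h2]
  continuation := by
    refine ⟨0, quadraticL c, ⟨differentiable_quadraticL c, 2, ?_⟩, fun s _ => by simp⟩
    refine IsBigO.of_bound (3 + |c|) ?_
    filter_upwards [tendsto_norm_cobounded_atTop.eventually_ge_atTop 2] with s hs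
    refine (norm_quadraticL_le c s).trans ?_
    rw [Real.norm_of_nonneg (Real.exp_pos _).le, Real.rpow_two]
    gcongr
    nlinarith
  functional_equation := ⟨quadraticFE, satisfiesFE_quadraticL c⟩

/-- The difference `2^{-s}` of the two L-functions has no zeros. -/
lemma quadraticL_ne (s : ℂ) : quadraticL 0 s ≠ quadraticL 1 s := by
  simp [quadraticL, Complex.cpow_eq_zero_iff]

variable {g L₁ L₂ : ℂ → ℂ}

lemma eventually_exp_ne_one (hg : Differentiable ℂ g) (h : ∃ w, exp (g w) ≠ 1) :
    ∀ᶠ s in codiscrete ℂ, exp (g s) ≠ 1 := by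
  obtain ⟨w, hw⟩ := h
  have hd : Differentiable ℂ fun s => exp (g s) - 1 := (hg.cexp).sub_const 1
  filter_upwards [eventually_codiscrete_ne_zero (meromorphic_of_differentiable hd)
    (hd w).continuousAt (sub_ne_zero.2 hw)] with s hs
  exact sub_ne_zero.1 hs

lemma meromorphic_target (hL₁ : IsLFunction L₁) (hL₂ : IsLFunction L₂) (hg : Differentiable ℂ g) :
    Meromorphic (target g L₁ L₂) :=
  meromorphic_movingTarget hL₁ hL₂ (meromorphic_of_differentiable hg.cexp)

/-- `L₁` minus the target is the unit `exp g` times `L₂` minus the target. -/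
lemma sameZeros_target (hg : Differentiable ℂ g) (h : ∃ w, exp (g w) ≠ 1) :
    SameZeros (fun s => L₁ s - target g L₁ L₂ s) (fun s => L₂ s - target g L₁ L₂ s) := by
  intro z
  have he : (fun s => L₁ s - target g L₁ L₂ s) =ᶠ[𝓝[≠] z]
      (fun s => exp (g s)) * fun s => L₂ s - target g L₁ L₂ s := by
    filter_upwards [eventually_nhdsNE_of_codiscrete (eventually_exp_ne_one hg h) z] with s hs
    have hs' : exp (g s) - 1 ≠ 0 := sub_ne_zero.2 hs
    simp only [Pi.mul_apply, target]
    field_simp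
    ring
  rw [meromorphicOrderAt_congr he, meromorphicOrderAt_mul_of_ne_zero (hg.cexp.analyticAt z)
    (exp_ne_zero _)]

/-- The target has a pole wherever `exp g = 1` and `L₁ ≠ L₂`. -/
lemma hasPole_target (hg : Differentiable ℂ g) (h : ∃ w, exp (g w) ≠ 1)
    (hL₁ : Differentiable ℂ L₁) (hL₂ : Differentiable ℂ L₂) {z : ℂ} (hz : exp (g z) = 1)
    (hne : L₁ z ≠ L₂ z) : HasPole (target g L₁ L₂) := by
  refine ⟨z, ?_⟩
  have a1 : AnalyticAt ℂ (fun s => exp (g s) * L₂ s - L₁ s) z :=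
    ((hg.cexp.mul hL₂).sub hL₁).analyticAt z
  have a2 : AnalyticAt ℂ (fun s => exp (g s) - 1) z := (hg.cexp.sub_const 1).analyticAt z
  have o1 : meromorphicOrderAt (fun s => exp (g s) * L₂ s - L₁ s) z = 0 := by
    refine a1.meromorphicNFAt.meromorphicOrderAt_eq_zero_iff.2 ?_
    rw [hz, one_mul]
    exact sub_ne_zero.2 hne.symm
  have o2 : 0 < meromorphicOrderAt (fun s => exp (g s) - 1) z := by
    refine lt_of_le_of_ne a2.meromorphicOrderAt_nonneg fun h0 => ?_
    exact a2.meromorphicNFAt.meromorphicOrderAt_eq_zero_iff.1 h0.symm (by rw [hz, sub_self])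
  have o3 : meromorphicOrderAt (fun s => exp (g s) - 1) z ≠ ⊤ := by
    rw [meromorphicOrderAt_ne_top_iff_eventually_ne_zero a2.meromorphicAt]
    filter_upwards [eventually_nhdsNE_of_codiscrete (eventually_exp_ne_one hg h) z] with s hs
    exact sub_ne_zero.2 hs
  have e : meromorphicOrderAt (target g L₁ L₂) z = _ :=
    meromorphicOrderAt_div a1.meromorphicAt a2.meromorphicAt
  rw [e, o1]
  obtain ⟨b, hb⟩ := WithTop.ne_top_iff_exists.1 o3
  rw [← hb] at o2 ⊢
  have hb0 : 0 < b := by exact_mod_cast o2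
  have : ((0 - b : ℤ) : WithTop ℤ) < 0 := by
    exact_mod_cast (by omega : 0 - b < 0)
  simpa using this

lemma not_isRational_of_growthOrder_pos {f : ℂ → ℂ} (hf : 0 < growthOrder f) : ¬ IsRational f :=
  fun h => hf.not_ge (by simpa using h.hasOrderLE.growthOrder_le le_rfl)

lemma exp_one_ne_one : exp (1 : ℂ) ≠ 1 := by
  intro h
  have := congrArg norm h
  rw [Complex.norm_exp, norm_one, Complex.one_re, Real.exp_eq_one_iff] at this
  exact one_ne_zero this

/-- If the target with multiplier `exp (g s)` has finite order, then `g` is a polynomial. -/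
lemma exists_polynomial_of_growthOrder_target_ne_top (hL₁ : IsLFunction L₁) (hL₂ : IsLFunction L₂)
    (hne : ∃ s, s ≠ 1 ∧ L₁ s ≠ L₂ s) (hg : Differentiable ℂ g) (h : ∃ w, exp (g w) ≠ 1)
    (hfin : growthOrder (target g L₁ L₂) ≠ ⊤) : ∃ p : ℂ[X], ∀ s, g s = p.eval s := by
  obtain ⟨k, hk⟩ := exists_hasOrderLE_of_growthOrder_ne_top hfin
  have hk1 : (1 : ℝ) ≤ k + 1 := by simp
  exact exists_polynomial_of_hasOrderLE_exp hg ((HasOrderLE.multiplier hk1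
    (meromorphic_target hL₁ hL₂ hg) (hk.mono (by simp)) hL₁ hL₂).congr
    (eventuallyEq_multiplier (eventually_ne_of_isLFunction hL₁ hL₂ hne)
      (eventually_exp_ne_one hg h) EventuallyEq.rfl))

lemma exp_ne_polynomial (p : ℂ[X]) : ¬ ∀ s, exp s = p.eval s := by
  intro h
  have h1 : HasOrderLE (fun s => exp ((X : ℂ[X]).eval s)) 0 := by
    refine (hasOrderLE_polynomial p).congr (Eventually.of_forall fun s => ?_)
    simp [h]
  have h2 := h1.natDegree_le le_rfl
  simp only [natDegree_X, Nat.cast_one] at h2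
  linarith

lemma growthOrder_target_pow {F : FEData} (hL₁ : IsLFunction L₁) (hL₂ : IsLFunction L₂)
    (hF₁ : SatisfiesFE F L₁) (hF₂ : SatisfiesFE F L₂) (hne : ∃ s, s ≠ 1 ∧ L₁ s ≠ L₂ s)
    {m : ℕ} (hm : 0 < m) : growthOrder (target (fun s => s ^ m) L₁ L₂) = m := by
  have h1 : ∃ s : ℂ, s ≠ 1 ∧ (s - 1) ^ (0 : ℤ) * exp (((X : ℂ[X]) ^ m).eval s) ≠ 1 := by
    by_contra! hcon
    have hd : Differentiable ℂ fun s : ℂ => exp (s ^ m) := by fun_prop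
    refine exp_one_ne_one ?_
    have := eq_of_eventuallyEq_codiscrete (f := fun s : ℂ => exp (s ^ m)) (g := fun _ => 1) (w := 1)
      ?_ (hd 1).continuousAt continuousAt_const
    · simpa using this
    · filter_upwards [compl_singleton_mem_codiscrete 1] with s hs
      simpa using hcon s hs
  have h2 := growthOrder_movingTarget hL₁ hL₂ hF₁ hF₂ hne h1
  rw [natDegree_X_pow, max_eq_right (Nat.one_le_iff_ne_zero.2 hm.ne')] at h2
  rw [← h2]
  congr 1
  funext s
  simp [target]

end MovingTarget

open MovingTarget in
theorem theorem3 :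
    (∀ (h L₁ L₂ : ℂ → ℂ) (F : FEData),
      IsTranscendentalMeromorphic h → HasPole h →
      growthOrder h ≠ ⊤ → (∀ n : ℕ, 0 < n → growthOrder h ≠ (n : EReal)) →
      IsLFunction L₁ → IsLFunction L₂ → SatisfiesFE F L₁ → SatisfiesFE F L₂ →
      SameZeros (fun s => L₁ s - h s) (fun s => L₂ s - h s) →
      ∀ s : ℂ, s ≠ 1 → L₁ s = L₂ s) ∧
    (∃ (L₁ L₂ : ℂ → ℂ) (F : FEData),
      IsLFunction L₁ ∧ IsLFunction L₂ ∧ SatisfiesFE F L₁ ∧ SatisfiesFE F L₂ ∧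
      (∃ s : ℂ, s ≠ 1 ∧ L₁ s ≠ L₂ s) ∧
      (∀ m : ℕ, 0 < m →
        IsTranscendentalMeromorphic (target (fun s => s ^ m) L₁ L₂) ∧
        HasPole (target (fun s => s ^ m) L₁ L₂) ∧
        growthOrder (target (fun s => s ^ m) L₁ L₂) = (m : EReal) ∧
        SameZeros (fun s => L₁ s - target (fun s => s ^ m) L₁ L₂ s)
          (fun s => L₂ s - target (fun s => s ^ m) L₁ L₂ s)) ∧
      IsTranscendentalMeromorphic (target Complex.exp L₁ L₂) ∧
      HasPole (target Complex.exp L₁ L₂) ∧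
      growthOrder (target Complex.exp L₁ L₂) = ⊤ ∧
      SameZeros (fun s => L₁ s - target Complex.exp L₁ L₂ s)
        (fun s => L₂ s - target Complex.exp L₁ L₂ s)) := by
  refine ⟨fun h L₁ L₂ F hh _ hfin hord hL₁ hL₂ hF₁ hF₂ hz => ?_, ?_⟩
  · by_contra! hne
    obtain ⟨n, hn, h⟩ := exists_growthOrder_eq hh.1 hfin hL₁ hL₂ hF₁ hF₂ hz hne
    exact hord n hn h
  · -- the L-functions `1 + 2 · 4^{-s}` and `1 + 2^{-s} + 2 · 4^{-s}`
    have hL (c : ℝ) := isLFunction_quadraticL c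
    have hF (c : ℝ) := satisfiesFE_quadraticL c
    have hd (c : ℝ) := differentiable_quadraticL c
    have hne : ∃ s : ℂ, s ≠ 1 ∧ quadraticL 0 s ≠ quadraticL 1 s := ⟨0, zero_ne_one, quadraticL_ne 0⟩
    refine ⟨quadraticL 0, quadraticL 1, quadraticFE, hL 0, hL 1, hF 0, hF 1, hne,
      fun m hm => ?_, ?_⟩
    · have hg : Differentiable ℂ fun s : ℂ => s ^ m := by fun_prop
      have hw : ∃ w : ℂ, Complex.exp (w ^ m) ≠ 1 := ⟨1, by simpa using exp_one_ne_one⟩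
      have hord := growthOrder_target_pow (hL 0) (hL 1) (hF 0) (hF 1) hne hm
      have hpos : 0 < growthOrder (target (fun s => s ^ m) (quadraticL 0) (quadraticL 1)) := by
        rw [hord]
        exact_mod_cast hm
      exact ⟨⟨meromorphic_target (hL 0) (hL 1) hg, not_isRational_of_growthOrder_pos hpos⟩,
        hasPole_target hg hw (hd 0) (hd 1) (z := 0) (by simp [hm.ne']) (quadraticL_ne 0), hord,
        sameZeros_target hg hw⟩
    · have hg : Differentiable ℂ Complex.exp := Complex.differentiable_exp
      have hw : ∃ w : ℂ, Complex.exp (Complex.exp w) ≠ 1 := ⟨0, by simpa using exp_one_ne_one⟩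
      have hord : growthOrder (target Complex.exp (quadraticL 0) (quadraticL 1)) = ⊤ := by
        by_contra hfin
        obtain ⟨p, hp⟩ :=
          exists_polynomial_of_growthOrder_target_ne_top (hL 0) (hL 1) hne hg hw hfin
        exact exp_ne_polynomial p hp
      have hpos : 0 < growthOrder (target Complex.exp (quadraticL 0) (quadraticL 1)) := by
        rw [hord]
        exact EReal.zero_lt_top
      -- `exp (exp z) = 1` at `z = log (2πi)`
      exact ⟨⟨meromorphic_target (hL 0) (hL 1) hg, not_isRational_of_growthOrder_pos hpos⟩,
        hasPole_target hg hw (hd 0) (hd 1) (z := Complex.log (2 * Real.pi * Complex.I))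
          (by rw [Complex.exp_log Complex.two_pi_I_ne_zero, Complex.exp_two_pi_mul_I])
          (quadraticL_ne _), hord, sameZeros_target hg hw⟩
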